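/- Let $N\ge 0$ and $d_1,\dots,d_N\ge 0$ be integers, and let $X=(X^1,\dots,X^N)$ be an integrable random vector whose $i$-th component $X^i$ takes values in $\mathbb{R}^{d_i}$ (no density is required; $\mathbb{E}\|X\|<\infty$ is assumed so that conditional expectations are defined). Let $W=(W^1,\dots,W^N)$ be a Gaussian random vector of the same dimension as $X$, with zero mean and identity covariance, independent of $X$, and for $t>0$ let $X_t=X+\sqrt{2t}\,W$, with components $X_t^i=X^i+\sqrt{2t}\,W^i$. Write $X^{\setminus i}=(X^j)_{j\ne i}$, let $I(U;V)\in[0,\infty]$ denote the mutual information in nats, i.e. the Kullback-Leibler divergence of the law of $(U,V)$ from the product of the laws of $U$ and $V$, and define the S-information $$\mathcal{S}(X)=\sum_{i=1}^N I(X^i;X^{\setminus i})\in[0,\infty].$$ Then, as an equality in $[0,\infty]$, $$\mathcal{S}(X)=\int_0^\infty\frac{1}{4t^2}\,\mathbb{E}\left\|\Big[\mathbb{E}[X^i\mid X^i_t]\Big]_{i=1}^N-\Big[\mathbb{E}[X^i\mid X^i_t,\,X^{\setminus i}]\Big]_{i=1}^N\right\|^2\,dt,$$ where $[\,\cdot\,]_{i=1}^N$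 denotes concatenation into one column vector of $\mathbb{R}^{d_1+\cdots+d_N}$ and $\|\cdot\|$ is the Euclidean norm. -/

import Mathlib

open MeasureTheory ProbabilityTheory InformationTheory
open scoped ENNReal

/-- Systems of `N` vectors, the `i`-th one in `ℝ^(d i)`, viewed as one concatenated column vector
with the Euclidean norm. -/
abbrev SysVec {N : ℕ} (d : Fin N → ℕ) : Type :=
  PiLp 2 (fun i : Fin N => EuclideanSpace ℝ (Fin (d i)))

/-- All components of a system but the `i`-th one. -/
def allBut {N : ℕ} {d : Fin N → ℕ} (i : Fin N) (x : SysVec d) :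
    (j : {j : Fin N // j ≠ i}) → EuclideanSpace ℝ (Fin (d j)) :=
  fun j => x j

/-- Mutual information `I(U; V)` (in nats, possibly infinite): the Kullback-Leibler divergence of
the joint law from the product of the marginal laws. -/
noncomputable def mutualInformation {Ω α β : Type*} [MeasurableSpace Ω] [MeasurableSpace α]
    [MeasurableSpace β] (μ : Measure Ω) (U : Ω → α) (V : Ω → β) : ℝ≥0∞ :=
  klDiv (μ.map (fun ω => (U ω, V ω))) ((μ.map U).prod (μ.map V))

/-- The S-information: the sum over `i` of the mutual information between the `i`-th component
and the collection of all the other components. -/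
noncomputable def sInformation {Ω : Type*} [MeasurableSpace Ω] {N : ℕ} {d : Fin N → ℕ}
    (μ : Measure Ω) (X : Ω → SysVec d) : ℝ≥0∞ :=
  ∑ i : Fin N, mutualInformation μ (fun ω => X ω i) (fun ω => allBut i (X ω))

/-- The noised version `X_t = X + √(2t) W` of `X`. -/
noncomputable def noised {Ω : Type*} {N : ℕ} {d : Fin N → ℕ} (X W : Ω → SysVec d) (t : ℝ) :
    Ω → SysVec d :=
  fun ω => X ω + Real.sqrt (2 * t) • W ω

/-- The concatenation over `i` of the conditional expectations `E[X^i | X^i_t]`. -/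
noncomputable def marginalDenoiser {Ω : Type*} [MeasurableSpace Ω] {N : ℕ} {d : Fin N → ℕ}
    (μ : Measure Ω) (X W : Ω → SysVec d) (t : ℝ) : Ω → SysVec d :=
  fun ω => WithLp.toLp 2 fun i : Fin N =>
    (μ[fun ω' => X ω' i |
      MeasurableSpace.comap (fun ω' => noised X W t ω' i) inferInstance]) ω

/-- The concatenation over `i` of the conditional expectations `E[X^i | X^i_t, X^{∖i}]`: only the
`i`-th component is noised, the other ones are observed without noise. -/
noncomputable def conditionalDenoiser {Ω : Type*} [MeasurableSpace Ω] {N : ℕ} {d : Fin N → ℕ}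
    (μ : Measure Ω) (X W : Ω → SysVec d) (t : ℝ) : Ω → SysVec d :=
  fun ω => WithLp.toLp 2 fun i : Fin N =>
    (μ[fun ω' => X ω' i |
      MeasurableSpace.comap (fun ω' => (noised X W t ω' i, allBut i (X ω'))) inferInstance]) ω

/-! Everything reduces to an identity for two arbitrary probability measures `P`, `Q` on a Euclidean
space (`klDiv_eq_denoisingDiv`): their relative entropy is the integral over noise levels `t` of
`1/(4t²)` times the mean squared distance, under `P` plus noise, between the Bayes estimators with
priors `P` and `Q`. Applied to the conditional law of `X^i` given the other components and to its
marginal law, then averaged over those components, it gives each mutual information.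

Let `p_t`, `q_t` be the densities of `P`, `Q` convolved with the heat kernel. Since `∂ₜ p_t = Δ
p_t`, and likewise for `q_t`, integration by parts gives de Bruijn's identity `d/dt ∫ p_t
log(p_t/q_t) = -∫ p_t |∇log p_t - ∇log q_t|²`. Tweedie's formula says `∇log p_t(y) = (m_P(y) -
y)/(2t)`, with `m_P` the posterior mean, so the observation `y` cancels in the difference of scores
and the factor `1/(4t²)` appears. Integrating over `(0,∞)` requires the entropy to vanish as `t → ∞`
and to recover `klDiv P Q` as `t → 0`.

Differentiation, integrability and the limit at infinity are controlled when `P` and `Q` have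
mutually bounded densities (`Comparable`), because `log(p_t/q_t)` is then bounded uniformly in `t`.
The limit at zero uses the dual formula `KL = sup_g ∫ g dP - ∫ (e^g - 1) dQ`: this functional is
affine in the pair of measures, so it averages over the noise and passes to weak limits.

General `P`, `Q` are reached through the mixtures `P' = aP + bQ`, `Q' = aQ + bP'` with `a + b = 1`,
`b → 0`. These are comparable, and neither side of the identity exceeds its value at `(P, Q)`; lower
semicontinuity of both sides then transfers the identity, infinite values included.

Finally, Bayes' rule identifies the conditional expectations with posterior means. The marginal
estimator is the case of trivial side information. -/

set_option linter.unusedSectionVars false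

/-! ### The heat kernel, its derivatives and its Gaussian interpretation. -/

section HeatKernel

open Real Filter Topology

variable {E : Type*} [NormedAddCommGroup E] [InnerProductSpace ℝ E]

/-- The heat kernel of a Euclidean space: the density of a centred Gaussian vector with
covariance `2t`. -/
noncomputable def heatKernel (t : ℝ) (x : E) : ℝ :=
  (4 * π * t) ^ (-(Module.finrank ℝ E : ℝ) / 2) * exp (-‖x‖ ^ 2 / (4 * t))

lemma heatKernel_pos {t : ℝ} (ht : 0 < t) (x : E) : 0 < heatKernel t x := by
  unfold heatKernel; positivity

lemma continuous_heatKernel (t : ℝ) : Continuous (heatKernel t : E → ℝ) := by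
  unfold heatKernel; fun_prop

lemma measurable_heatKernel_uncurry [MeasurableSpace E] [BorelSpace E] :
    Measurable fun z : ℝ × E => heatKernel z.1 z.2 := by
  unfold heatKernel; fun_prop

lemma heatKernel_le {t : ℝ} (ht : 0 < t) (x : E) :
    heatKernel t x ≤ (4 * π * t) ^ (-(Module.finrank ℝ E : ℝ) / 2) := by
  unfold heatKernel
  refine mul_le_of_le_one_right (by positivity) (exp_le_one_iff.2 ?_)
  rw [neg_div]; simp; positivity

/-- For `s < 2t` the exponential is at most `exp(-‖x‖²/(16t))²`: one factor absorbs the polynomial,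
the other is the kernel at time `4t` up to normalisation. Uniformity in `s` near `t` is what allows
differentiation in time under the integral. -/
lemma exists_mul_heatKernel_le {t : ℝ} (ht : 0 < t) :
    ∃ C, 0 < C ∧ ∀ s ∈ Set.Ioo (t / 2) (2 * t), ∀ x : E,
      (1 + ‖x‖ ^ 2) * heatKernel s x ≤ C * heatKernel (4 * t) x := by
  set a : ℝ := -(Module.finrank ℝ E : ℝ) / 2 with ha
  have ha0 : a ≤ 0 := by rw [ha, neg_div]; simp; positivity
  have h1 : 0 < (4 * π * (4 * t)) ^ a := by positivity
  refine ⟨(1 + 16 * t) * (4 * π * (t / 2)) ^ a / (4 * π * (4 * t)) ^ a, by positivity, ?_⟩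
  intro s hs x
  have hs0 : 0 < s := by linarith [hs.1]
  have e1 : (4 * π * s) ^ a ≤ (4 * π * (t / 2)) ^ a := by
    apply rpow_le_rpow_of_nonpos (by positivity) _ ha0
    have := hs.1
    gcongr
  have e2 : exp (-‖x‖ ^ 2 / (4 * s)) ≤ exp (-(‖x‖ ^ 2 / (16 * t))) * exp (-(‖x‖ ^ 2 / (16 * t))) := by
    rw [← exp_add, exp_le_exp, neg_div, ← neg_add, neg_le_neg_iff]
    have : ‖x‖ ^ 2 / (16 * t) + ‖x‖ ^ 2 / (16 * t) = ‖x‖ ^ 2 / (4 * (2 * t)) := by field_simp; ring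
    rw [this]
    have := hs.2
    gcongr
  have e3 : (1 + ‖x‖ ^ 2) * exp (-(‖x‖ ^ 2 / (16 * t))) ≤ 1 + 16 * t := by
    have h := add_one_le_exp (‖x‖ ^ 2 / (16 * t))
    rw [exp_neg, ← div_eq_mul_inv, div_le_iff₀ (exp_pos _)]
    have h0 : (1:ℝ) ≤ exp (‖x‖ ^ 2 / (16 * t)) := one_le_exp (by positivity)
    have h2 : ‖x‖ ^ 2 ≤ 16 * t * exp (‖x‖ ^ 2 / (16 * t)) := by
      calc ‖x‖ ^ 2 = 16 * t * (‖x‖ ^ 2 / (16 * t)) := by field_simp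
        _ ≤ _ := by gcongr; linarith
    linarith
  have e4 : -‖x‖ ^ 2 / (4 * (4 * t)) = -(‖x‖ ^ 2 / (16 * t)) := by rw [neg_div]; congr 2; ring
  unfold heatKernel
  rw [← ha, e4]
  calc (1 + ‖x‖ ^ 2) * ((4 * π * s) ^ a * exp (-‖x‖ ^ 2 / (4 * s)))
      ≤ (1 + ‖x‖ ^ 2) * ((4 * π * (t / 2)) ^ a *
          (exp (-(‖x‖ ^ 2 / (16 * t))) * exp (-(‖x‖ ^ 2 / (16 * t))))) := by gcongr
    _ = ((1 + ‖x‖ ^ 2) * exp (-(‖x‖ ^ 2 / (16 * t)))) * ((4 * π * (t / 2)) ^ a *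
          exp (-(‖x‖ ^ 2 / (16 * t)))) := by ring
    _ ≤ (1 + 16 * t) * ((4 * π * (t / 2)) ^ a * exp (-(‖x‖ ^ 2 / (16 * t)))) := by gcongr
    _ = _ := by field_simp

/-- The directional derivative of the heat kernel. -/
noncomputable def heatKernelDeriv (v : E) (t : ℝ) (x : E) : ℝ :=
  -(inner ℝ x v / (2 * t)) * heatKernel t x

/-- The second directional derivative of the heat kernel. -/
noncomputable def heatKernelDeriv2 (v : E) (t : ℝ) (x : E) : ℝ :=
  (inner ℝ x v ^ 2 / (4 * t ^ 2) - ‖v‖ ^ 2 / (2 * t)) * heatKernel t x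

/-- The time derivative of the heat kernel. -/
noncomputable def heatKernelTimeDeriv (t : ℝ) (x : E) : ℝ :=
  (‖x‖ ^ 2 / (4 * t ^ 2) - Module.finrank ℝ E / (2 * t)) * heatKernel t x

lemma continuous_heatKernelDeriv (v : E) (t : ℝ) : Continuous (heatKernelDeriv v t) := by
  unfold heatKernelDeriv
  have := continuous_heatKernel (E := E) t
  fun_prop

lemma continuous_heatKernelDeriv2 (v : E) (t : ℝ) : Continuous (heatKernelDeriv2 v t) := by
  unfold heatKernelDeriv2
  have := continuous_heatKernel (E := E) t
  fun_prop

lemma continuous_heatKernelTimeDeriv (t : ℝ) : Continuous (heatKernelTimeDeriv (E := E) t) := by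
  unfold heatKernelTimeDeriv
  have := continuous_heatKernel (E := E) t
  fun_prop

lemma hasLineDerivAt_heatKernel {t : ℝ} (ht : 0 < t) (x v : E) :
    HasLineDerivAt ℝ (heatKernel t) (heatKernelDeriv v t x) x v := by
  have h1 : HasFDerivAt (fun y : E => ‖y‖ ^ 2) (2 • innerSL ℝ x) x :=
    (hasStrictFDerivAt_norm_sq x).hasFDerivAt
  have h2 : HasLineDerivAt ℝ (fun y : E => ‖y‖ ^ 2) (2 * inner ℝ x v) x v := by
    simpa using h1.hasLineDerivAt v
  unfold HasLineDerivAt at h2 ⊢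
  unfold heatKernel heatKernelDeriv
  refine (((h2.fun_neg.div_const (4 * t)).exp).const_mul
    ((4 * π * t) ^ (-(Module.finrank ℝ E : ℝ) / 2))).congr_deriv ?_
  simp only [zero_smul, add_zero, heatKernel]
  field_simp
  ring

lemma hasLineDerivAt_heatKernelDeriv {t : ℝ} (ht : 0 < t) (x v : E) :
    HasLineDerivAt ℝ (heatKernelDeriv v t) (heatKernelDeriv2 v t x) x v := by
  have h1 := hasLineDerivAt_heatKernel ht x v
  have h2 : HasLineDerivAt ℝ (fun y : E => (inner ℝ y v : ℝ)) (‖v‖ ^ 2) x v := by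
    have h := ((innerSL ℝ v).hasFDerivAt (x := x)).hasLineDerivAt v
    simp only [innerSL_apply_apply, real_inner_self_eq_norm_sq] at h
    convert h using 2
    exact real_inner_comm _ _
  unfold HasLineDerivAt at h1 h2 ⊢
  unfold heatKernelDeriv
  refine (((h2.div_const (2 * t)).fun_neg).mul h1).congr_deriv ?_
  simp only [zero_smul, add_zero, heatKernelDeriv, heatKernelDeriv2]
  field_simp
  ring

lemma hasDerivAt_heatKernel {t : ℝ} (ht : 0 < t) (x : E) :
    HasDerivAt (fun s => heatKernel s x) (heatKernelTimeDeriv t x) t := by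
  have h1 : HasDerivAt (fun s : ℝ => 4 * π * s) (4 * π) t := by
    simpa using (hasDerivAt_id t).const_mul (4 * π)
  have h2 : HasDerivAt (fun s : ℝ => 4 * s) 4 t := by
    simpa using (hasDerivAt_id t).const_mul (4 : ℝ)
  have hpos : 4 * π * t ≠ 0 := by positivity
  have h3 := h1.rpow_const (p := -(Module.finrank ℝ E : ℝ) / 2) (Or.inl hpos)
  have h4 := ((hasDerivAt_const t (-‖x‖ ^ 2)).fun_div h2 (by positivity)).exp
  unfold heatKernel heatKernelTimeDeriv
  refine (h3.mul h4).congr_deriv ?_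
  rw [rpow_sub_one hpos, heatKernel]
  have := pi_ne_zero
  field_simp
  ring

/-- The heat equation, with the Laplacian written in an orthonormal basis. -/
lemma sum_heatKernelDeriv2 {ι : Type*} [Fintype ι] (b : OrthonormalBasis ι ℝ E) (t : ℝ) (x : E) :
    ∑ i, heatKernelDeriv2 (b i) t x = heatKernelTimeDeriv t x := by
  unfold heatKernelDeriv2 heatKernelTimeDeriv
  rw [← Finset.sum_mul, Finset.sum_sub_distrib, ← Finset.sum_div, b.sum_sq_inner_left]
  simp [Module.finrank_eq_card_basis b.toBasis, div_eq_mul_inv]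

variable [FiniteDimensional ℝ E] [MeasurableSpace E] [BorelSpace E]

lemma integrable_heatKernel {t : ℝ} (ht : 0 < t) : Integrable (heatKernel t : E → ℝ) := by
  unfold heatKernel
  refine Integrable.const_mul ?_ _
  have h : 0 < ((1 / (4 * t) : ℝ) : ℂ).re := by simp; positivity
  have := (GaussianFourier.integrable_cexp_neg_mul_sq_norm_add (V := E) h 0 0).re
  convert this using 2 with x
  simp only [zero_mul, add_zero]
  rw [← Complex.ofReal_pow, ← Complex.ofReal_neg, ← Complex.ofReal_mul]
  rw [← Complex.ofReal_exp]
  simp only [RCLike.re_to_complex, Complex.ofReal_re]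
  congr 1; ring

lemma integral_heatKernel {t : ℝ} (ht : 0 < t) : ∫ x : E, heatKernel t x = 1 := by
  unfold heatKernel
  rw [integral_const_mul]
  have h := GaussianFourier.integral_rexp_neg_mul_sq_norm (V := E)
    (b := 1 / (4 * t)) (by positivity)
  have e : ∀ x : E, -‖x‖ ^ 2 / (4 * t) = -(1 / (4 * t)) * ‖x‖ ^ 2 := fun x => by ring
  simp_rw [e]
  rw [h, neg_div, rpow_neg (by positivity), show π / (1 / (4 * t)) = 4 * π * t by field_simp]
  exact inv_mul_cancel₀ (by positivity)

/-- Both measures have characteristic function `exp(-t‖w‖²)`. -/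
lemma map_smul_stdGaussian {t : ℝ} (ht : 0 < t) :
    (stdGaussian E).map (fun x => √(2 * t) • x) =
      volume.withDensity (fun x => ENNReal.ofReal (heatKernel t x)) := by
  have : IsFiniteMeasure (volume.withDensity fun x : E => ENNReal.ofReal (heatKernel t x)) :=
    isFiniteMeasure_withDensity_ofReal (integrable_heatKernel ht).2
  have : IsProbabilityMeasure ((stdGaussian E).map (fun x => √(2 * t) • x)) :=
    Measure.isProbabilityMeasure_map (by fun_prop)
  apply Measure.ext_of_charFun
  ext w
  rw [charFun_map_smul, charFun_stdGaussian, charFun_apply,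
    integral_withDensity_eq_integral_toReal_smul₀ (by
      have := (continuous_heatKernel (E := E) t).measurable
      fun_prop) (by simp)]
  have hb : 0 < ((1 / (4 * t) : ℝ) : ℂ).re := by simp; positivity
  have h := GaussianFourier.integral_cexp_neg_mul_sq_norm_add (V := E) hb Complex.I w
  have e : ∀ x : E, (ENNReal.ofReal (heatKernel t x)).toReal •
      Complex.exp ((inner ℝ x w : ℝ) * Complex.I) =
      (((4 * π * t) ^ (-(Module.finrank ℝ E : ℝ) / 2) : ℝ) : ℂ) *
      Complex.exp (-((1 / (4 * t) : ℝ) : ℂ) * ‖x‖ ^ 2 + Complex.I * (inner ℝ w x : ℝ)) := by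
    intro x
    rw [ENNReal.toReal_ofReal (heatKernel_pos ht x).le, heatKernel, Complex.exp_add,
      real_inner_comm, Complex.real_smul]
    push_cast
    rw [mul_comm Complex.I, mul_assoc]
    congr 3
    ring
  simp_rw [e]
  rw [integral_const_mul, h, ← mul_assoc]
  have e2 : (((4 * π * t) ^ (-(Module.finrank ℝ E : ℝ) / 2) : ℝ) : ℂ) *
      ((π : ℂ) / ((1 / (4 * t) : ℝ) : ℂ)) ^ ((Module.finrank ℝ E : ℂ) / 2) = 1 := by
    rw [neg_div, rpow_neg (by positivity), ← Complex.ofReal_div,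
      show π / (1 / (4 * t)) = 4 * π * t by field_simp,
      show ((Module.finrank ℝ E : ℂ) / 2) = (((Module.finrank ℝ E : ℝ) / 2 : ℝ) : ℂ) by simp,
      ← Complex.ofReal_cpow (by positivity), ← Complex.ofReal_mul,
      inv_mul_cancel₀ (by positivity), Complex.ofReal_one]
  rw [e2, one_mul, Complex.I_sq, norm_smul, norm_of_nonneg (sqrt_nonneg _)]
  congr 1
  have : √(2 * t) ^ 2 = 2 * t := sq_sqrt (by positivity)
  rw [← Complex.ofReal_pow, mul_pow, this]
  have : (t : ℂ) ≠ 0 := by exact_mod_cast ht.ne'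
  push_cast
  field_simp

end HeatKernel

/-! ### Convolution of a probability measure with heat-kernel-like functions. -/

section Smoothing

open Real Filter Topology
open scoped NNReal

variable {E : Type*} [NormedAddCommGroup E] [InnerProductSpace ℝ E]

/-- A continuous function dominated by a multiple of a heat kernel. -/
def HeatBounded (ψ : E → ℝ) : Prop :=
  Continuous ψ ∧ ∃ C s : ℝ, 0 < s ∧ ∀ x, |ψ x| ≤ C * heatKernel s x

lemma HeatBounded.of_le {ψ : E → ℝ} (hψ : Continuous ψ) {t : ℝ} (ht : 0 < t) (c : ℝ)
    (h : ∀ x, |ψ x| ≤ c * ((1 + ‖x‖ ^ 2) * heatKernel t x)) : HeatBounded ψ := by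
  obtain ⟨C, hC, hb⟩ := exists_mul_heatKernel_le (E := E) ht
  refine ⟨hψ, |c| * C, 4 * t, by positivity, fun x => (h x).trans ?_⟩
  have h1 : 0 ≤ (1 + ‖x‖ ^ 2) * heatKernel t x :=
    mul_nonneg (by positivity) (heatKernel_pos ht x).le
  rw [mul_assoc]
  exact mul_le_mul (le_abs_self c) (hb t ⟨by linarith, by linarith⟩ x) h1 (abs_nonneg c)

lemma HeatBounded.exists_bound {ψ : E → ℝ} (hψ : HeatBounded ψ) : ∃ B, ∀ x, |ψ x| ≤ B := by
  obtain ⟨-, C, s, hs, h⟩ := hψ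
  refine ⟨|C| * (4 * π * s) ^ (-(Module.finrank ℝ E : ℝ) / 2), fun x => (h x).trans ?_⟩
  exact mul_le_mul (le_abs_self C) (heatKernel_le hs x) (heatKernel_pos hs x).le (abs_nonneg C)

lemma heatBounded_heatKernel {t : ℝ} (ht : 0 < t) : HeatBounded (heatKernel t : E → ℝ) :=
  ⟨continuous_heatKernel t, 1, t, ht, fun x => by
    rw [abs_of_pos (heatKernel_pos ht x), one_mul]⟩

lemma abs_inner_le_one_add_sq_mul (x v : E) :
    |(inner ℝ x v : ℝ)| ≤ ‖v‖ * (1 + ‖x‖ ^ 2) := by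
  have h := abs_real_inner_le_norm x v
  nlinarith [norm_nonneg x, norm_nonneg v, sq_nonneg (‖x‖ - 1)]

lemma heatBounded_heatKernelDeriv (v : E) {t : ℝ} (ht : 0 < t) :
    HeatBounded (heatKernelDeriv v t) := by
  refine .of_le (continuous_heatKernelDeriv v t) ht (‖v‖ / (2 * t)) fun x => ?_
  rw [heatKernelDeriv, abs_mul, abs_of_pos (heatKernel_pos ht x), ← mul_assoc]
  refine mul_le_mul_of_nonneg_right ?_ (heatKernel_pos ht x).le
  rw [abs_neg, abs_div, abs_of_pos (show 0 < 2 * t by positivity), div_mul_eq_mul_div]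
  gcongr
  exact abs_inner_le_one_add_sq_mul x v

lemma inner_sq_le (x v : E) : (inner ℝ x v : ℝ) ^ 2 ≤ ‖v‖ ^ 2 * ‖x‖ ^ 2 := by
  rw [← sq_abs, ← mul_pow, mul_comm]
  gcongr
  exact abs_real_inner_le_norm x v

lemma heatBounded_inner_sq_mul_heatKernel (v : E) {t : ℝ} (ht : 0 < t) :
    HeatBounded fun x : E => (inner ℝ x v / (2 * t)) ^ 2 * heatKernel t x := by
  have hc := continuous_heatKernel (E := E) t
  refine .of_le (by fun_prop) ht (‖v‖ ^ 2 / (2 * t) ^ 2) fun x => ?_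
  rw [abs_mul, abs_of_pos (heatKernel_pos ht x), ← mul_assoc]
  refine mul_le_mul_of_nonneg_right ?_ (heatKernel_pos ht x).le
  rw [abs_of_nonneg (sq_nonneg _), div_pow, div_mul_eq_mul_div]
  gcongr
  nlinarith [inner_sq_le x v, sq_nonneg ‖v‖]

lemma heatBounded_heatKernelDeriv2 (v : E) {t : ℝ} (ht : 0 < t) :
    HeatBounded (heatKernelDeriv2 v t) := by
  refine .of_le (continuous_heatKernelDeriv2 v t) ht
    (‖v‖ ^ 2 / (4 * t ^ 2) + ‖v‖ ^ 2 / (2 * t)) fun x => ?_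
  rw [heatKernelDeriv2, abs_mul, abs_of_pos (heatKernel_pos ht x), ← mul_assoc]
  refine mul_le_mul_of_nonneg_right ?_ (heatKernel_pos ht x).le
  refine (abs_sub _ _).trans ?_
  rw [abs_of_nonneg (by positivity), abs_of_nonneg (by positivity)]
  have h1 : inner ℝ x v ^ 2 / (4 * t ^ 2) ≤ ‖v‖ ^ 2 * ‖x‖ ^ 2 / (4 * t ^ 2) := by
    gcongr; exact inner_sq_le x v
  have h2 : 0 ≤ ‖v‖ ^ 2 / (4 * t ^ 2) := by positivity
  have h3 : 0 ≤ ‖v‖ ^ 2 / (2 * t) * ‖x‖ ^ 2 := by positivity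
  have h4 : ‖v‖ ^ 2 * ‖x‖ ^ 2 / (4 * t ^ 2) = ‖v‖ ^ 2 / (4 * t ^ 2) * ‖x‖ ^ 2 := by ring
  linarith

lemma exists_heatKernelTimeDeriv_le {t : ℝ} (ht : 0 < t) :
    ∃ C, 0 ≤ C ∧ ∀ s ∈ Set.Ioo (t / 2) (2 * t), ∀ x : E,
      |heatKernelTimeDeriv s x| ≤ C * heatKernel (4 * t) x := by
  obtain ⟨C, hC, hb⟩ := exists_mul_heatKernel_le (E := E) ht
  refine ⟨(1 / t ^ 2 + Module.finrank ℝ E / t) * C, by positivity, fun s hs x => ?_⟩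
  have hs0 : 0 < s := by linarith [hs.1]
  have hs1 := hs.1
  rw [mul_assoc]
  refine le_trans ?_ (mul_le_mul_of_nonneg_left (hb s hs x) (by positivity))
  rw [heatKernelTimeDeriv, abs_mul, abs_of_pos (heatKernel_pos hs0 x), ← mul_assoc]
  refine mul_le_mul_of_nonneg_right ?_ (heatKernel_pos hs0 x).le
  refine (abs_sub _ _).trans ?_
  rw [abs_of_nonneg (by positivity), abs_of_nonneg (by positivity)]
  have h1 : ‖x‖ ^ 2 / (4 * s ^ 2) ≤ ‖x‖ ^ 2 / t ^ 2 := by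
    gcongr
    nlinarith
  have h2 : (Module.finrank ℝ E : ℝ) / (2 * s) ≤ Module.finrank ℝ E / t := by
    gcongr
    linarith
  have h3 : ‖x‖ ^ 2 / t ^ 2 = 1 / t ^ 2 * ‖x‖ ^ 2 := by ring
  have h4 : 0 ≤ (Module.finrank ℝ E : ℝ) / t * ‖x‖ ^ 2 := by positivity
  have h5 : 0 ≤ 1 / t ^ 2 := by positivity
  linarith

lemma heatBounded_heatKernelTimeDeriv {t : ℝ} (ht : 0 < t) :
    HeatBounded (heatKernelTimeDeriv (E := E) t) := by
  obtain ⟨C, -, h⟩ := exists_heatKernelTimeDeriv_le (E := E) ht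
  exact ⟨continuous_heatKernelTimeDeriv t, C, 4 * t, by positivity,
    h t ⟨by linarith, by linarith⟩⟩

variable [MeasurableSpace E]

/-- The convolution of the measure `P` with the function `ψ`. -/
noncomputable def smoothing (P : Measure E) (ψ : E → ℝ) (y : E) : ℝ :=
  ∫ u, ψ (y - u) ∂P

variable [BorelSpace E] [FiniteDimensional ℝ E] (P Q : Measure E) [IsProbabilityMeasure P]
  [IsProbabilityMeasure Q]

lemma HeatBounded.integrable {ψ : E → ℝ} (hψ : HeatBounded ψ) : Integrable ψ := by
  obtain ⟨hc, C, s, hs, h⟩ := hψ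
  exact ((integrable_heatKernel hs).const_mul C).mono' hc.aestronglyMeasurable (ae_of_all _ h)

variable {P Q} in
lemma HeatBounded.integrable_sub {ψ : E → ℝ} (hψ : HeatBounded ψ) (y : E) :
    Integrable (fun u => ψ (y - u)) P := by
  obtain ⟨B, hB⟩ := hψ.exists_bound
  have := hψ.1
  exact .of_bound (by fun_prop) B (ae_of_all _ fun u => hB _)

lemma HeatBounded.continuous_smoothing {ψ : E → ℝ} (hψ : HeatBounded ψ) :
    Continuous (smoothing P ψ) := by
  obtain ⟨B, hB⟩ := hψ.exists_bound
  have := hψ.1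
  refine continuous_of_dominated (bound := fun _ => B) (fun y => ?_)
    (fun y => ae_of_all _ fun u => hB _) (integrable_const B) (ae_of_all _ fun u => ?_)
  · exact Continuous.aestronglyMeasurable (by fun_prop)
  · fun_prop

lemma HeatBounded.integrable_prod {ψ g : E → ℝ} (hψ : HeatBounded ψ) (hg : Continuous g) {B : ℝ}
    (hB : ∀ y, |g y| ≤ B) :
    Integrable (fun z : E × E => g (z.1 + z.2) * ψ z.2) (P.prod volume) := by
  have h := (integrable_const (1 : ℝ) (μ := P)).mul_prod hψ.integrable
  have := hψ.1
  refine (h.norm.const_mul B).mono' (Continuous.aestronglyMeasurable (by fun_prop))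
    (ae_of_all _ fun z => ?_)
  simp only [norm_mul, norm_eq_abs, one_mul]
  gcongr
  exact hB _

/-- The shear `(u, x) ↦ (u, u + x)` preserves `P × volume` by translation invariance, and turns the
integrand into that of `HeatBounded.integrable_prod`. -/
lemma HeatBounded.integrable_prod_sub {ψ g : E → ℝ} (hψ : HeatBounded ψ) (hg : Continuous g)
    {B : ℝ} (hB : ∀ y, |g y| ≤ B) :
    Integrable (fun z : E × E => g z.2 * ψ (z.2 - z.1)) (P.prod volume) := by
  have := hψ.1
  have hm : MeasurePreserving (fun z : E × E => (z.1, z.1 + z.2)) (P.prod volume)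
      (P.prod volume) :=
    (MeasurePreserving.id P).skew_product (g := fun u x => u + x)
      (Continuous.measurable (by fun_prop)) (ae_of_all _ fun u => map_add_left_eq_self volume u)
  rw [← hm.integrable_comp (Continuous.aestronglyMeasurable (by fun_prop))]
  simpa [Function.comp_def] using hψ.integrable_prod P hg hB

lemma HeatBounded.integrable_mul_smoothing {ψ g : E → ℝ} (hψ : HeatBounded ψ) (hg : Continuous g)
    {B : ℝ} (hB : ∀ y, |g y| ≤ B) : Integrable (fun y => g y * smoothing P ψ y) := by
  have := (hψ.integrable_prod_sub P hg hB).integral_prod_right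
  simpa only [integral_const_mul, smoothing] using this

lemma HeatBounded.integral_mul_smoothing {ψ g : E → ℝ} (hψ : HeatBounded ψ) (hg : Continuous g)
    {B : ℝ} (hB : ∀ y, |g y| ≤ B) :
    ∫ y, g y * smoothing P ψ y = ∫ u, (∫ x, g (u + x) * ψ x) ∂P := by
  unfold smoothing
  simp_rw [← integral_const_mul]
  rw [integral_integral_swap (f := fun y u => g y * ψ (y - u))
    (by simpa [Function.comp_def, Function.uncurry_def] using
      (hψ.integrable_prod_sub P hg hB).swap)]
  refine integral_congr_ae (ae_of_all _ fun u => ?_)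
  simp only
  rw [← integral_add_left_eq_self (fun y => g y * ψ (y - u)) u]
  simp

lemma HeatBounded.integrable_smoothing {ψ : E → ℝ} (hψ : HeatBounded ψ) :
    Integrable (smoothing P ψ) := by
  simpa using hψ.integrable_mul_smoothing P (g := fun _ => 1) continuous_const (B := 1) (by simp)

lemma integral_smoothing_heatKernel {t : ℝ} (ht : 0 < t) :
    ∫ y, smoothing P (heatKernel t) y = 1 := by
  have := (heatBounded_heatKernel ht).integral_mul_smoothing P (g := fun _ => 1)
    continuous_const (B := 1) (by simp)
  simpa [integral_heatKernel ht] using this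

lemma smoothing_pos {ψ : E → ℝ} (hψ : HeatBounded ψ) (hpos : ∀ x, 0 < ψ x) (y : E) :
    0 < smoothing P ψ y := by
  unfold smoothing
  rw [integral_pos_iff_support_of_nonneg (fun u => (hpos _).le) (hψ.integrable_sub y)]
  have : Function.support (fun u => ψ (y - u)) = Set.univ := by
    ext u; simp [(hpos (y - u)).ne']
  simp [this]

lemma smoothing_heatKernel_pos {t : ℝ} (ht : 0 < t) (y : E) : 0 < smoothing P (heatKernel t) y :=
  smoothing_pos P (heatBounded_heatKernel ht) (heatKernel_pos ht) y

variable {P Q} in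
lemma smoothing_le_of_le_smul {ψ : E → ℝ} (hψ : HeatBounded ψ) (h0 : ∀ x, 0 ≤ ψ x) {C : ℝ≥0}
    (h : P ≤ C • Q) (y : E) : smoothing P ψ y ≤ C * smoothing Q ψ y := by
  unfold smoothing
  calc ∫ u, ψ (y - u) ∂P ≤ ∫ u, ψ (y - u) ∂(C • Q) :=
        integral_mono_measure h (ae_of_all _ fun u => h0 _)
          ((hψ.integrable_sub (P := Q) y).smul_measure_nnreal)
    _ = _ := by rw [integral_smul_nnreal_measure]; rfl

lemma hasLineDerivAt_smoothing {ψ ψ' : E → ℝ} {v : E} (hψ : HeatBounded ψ) (hψ' : HeatBounded ψ')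
    (h : ∀ x, HasLineDerivAt ℝ ψ (ψ' x) x v) (y : E) :
    HasLineDerivAt ℝ (smoothing P ψ) (smoothing P ψ' y) y v := by
  obtain ⟨B, hB⟩ := hψ'.exists_bound
  have hc := hψ.1
  have hc' := hψ'.1
  unfold HasLineDerivAt smoothing
  have := (hasDerivAt_integral_of_dominated_loc_of_deriv_le (μ := P) (𝕜 := ℝ)
    (F := fun s u => ψ (y + s • v - u)) (F' := fun s u => ψ' (y + s • v - u)) (x₀ := 0)
    (bound := fun _ => B) Filter.univ_mem
    (.of_forall fun s => Continuous.aestronglyMeasurable (by fun_prop))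
    (by simpa using hψ.integrable_sub y)
    (Continuous.aestronglyMeasurable (by fun_prop))
    (ae_of_all _ fun u s _ => hB _) (integrable_const B)
    (ae_of_all _ fun u s _ => ?_)).2
  · simpa using this
  · have h1 := h (y + s • v - u)
    unfold HasLineDerivAt at h1
    -- A line derivative is a derivative at parameter `0`; the base point is moved along the line so
    -- that it becomes a derivative at `s`.
    have h2 : HasDerivAt (fun r : ℝ => ψ (y + s • v - u + (r - s) • v))
        (ψ' (y + s • v - u)) s := by
      have h3 : HasDerivAt (fun r : ℝ => ψ (y + s • v - u + r • v))
        (ψ' (y + s • v - u)) (s - s) := by simpa using h1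
      simpa using h3.comp_sub_const s s
    have e : (fun r : ℝ => ψ (y + r • v - u)) = fun r => ψ (y + s • v - u + (r - s) • v) := by
      ext r; congr 1; module
    rwa [e]

lemma hasDerivAt_smoothing_heatKernel {t : ℝ} (ht : 0 < t) (y : E) :
    HasDerivAt (fun s => smoothing P (heatKernel s) y)
      (smoothing P (heatKernelTimeDeriv t) y) t := by
  obtain ⟨C, hC, h⟩ := exists_heatKernelTimeDeriv_le (E := E) ht
  have hb : HeatBounded fun x : E => C * heatKernel (4 * t) x :=
    ⟨(continuous_heatKernel _).const_mul C, C, 4 * t, by positivity, fun x => by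
      rw [abs_of_nonneg (mul_nonneg hC (heatKernel_pos (by positivity) x).le)]⟩
  unfold smoothing
  refine (hasDerivAt_integral_of_dominated_loc_of_deriv_le (μ := P) (𝕜 := ℝ)
    (F := fun s u => heatKernel s (y - u)) (F' := fun s u => heatKernelTimeDeriv s (y - u))
    (bound := fun u => C * heatKernel (4 * t) (y - u)) 
    (Ioo_mem_nhds (show t / 2 < t by linarith) (show t < 2 * t by linarith))
    (.of_forall fun s => ?_) ((heatBounded_heatKernel ht).integrable_sub y) ?_
    (ae_of_all _ fun u s hs => h s hs _) (hb.integrable_sub y)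
    (ae_of_all _ fun u s hs => hasDerivAt_heatKernel (by linarith [hs.1]) _)).2
  · have := continuous_heatKernel (E := E) s
    exact Continuous.aestronglyMeasurable (by fun_prop)
  · have := continuous_heatKernelTimeDeriv (E := E) t
    exact Continuous.aestronglyMeasurable (by fun_prop)

lemma exists_smoothing_heatKernelTimeDeriv_le {t : ℝ} (ht : 0 < t) :
    ∃ C, 0 ≤ C ∧ ∀ s ∈ Set.Ioo (t / 2) (2 * t), ∀ y : E,
      |smoothing P (heatKernelTimeDeriv s) y| ≤ C * smoothing P (heatKernel (4 * t)) y := by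
  obtain ⟨C, hC, h⟩ := exists_heatKernelTimeDeriv_le (E := E) ht
  refine ⟨C, hC, fun s hs y => ?_⟩
  unfold smoothing
  rw [← integral_const_mul, ← norm_eq_abs]
  exact norm_integral_le_of_norm_le
    (((heatBounded_heatKernel (by positivity)).integrable_sub y).const_mul C)
    (ae_of_all _ fun u => h s hs _)

lemma sum_smoothing_heatKernelDeriv2 {ι : Type*} [Fintype ι] (b : OrthonormalBasis ι ℝ E) {t : ℝ}
    (ht : 0 < t) (y : E) :
    ∑ i, smoothing P (heatKernelDeriv2 (b i) t) y = smoothing P (heatKernelTimeDeriv t) y := by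
  unfold smoothing
  rw [← integral_finsetSum _ fun i _ => (heatBounded_heatKernelDeriv2 (b i) ht).integrable_sub y]
  simp_rw [sum_heatKernelDeriv2]

/-- The Fisher information density of `P` smoothed by the heat kernel is dominated. -/
lemma smoothing_heatKernelDeriv_sq_le (v : E) {t : ℝ} (ht : 0 < t) (y : E) :
    smoothing P (heatKernelDeriv v t) y ^ 2 / smoothing P (heatKernel t) y ≤
      smoothing P (fun x => (inner ℝ x v / (2 * t)) ^ 2 * heatKernel t x) y := by
  have hp := smoothing_heatKernel_pos P ht y
  set p := smoothing P (heatKernel t) y with hpdef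
  set a := smoothing P (heatKernelDeriv v t) y with hadef
  have i0 := (heatBounded_heatKernel ht).integrable_sub (P := P) y
  have i1 := (heatBounded_heatKernelDeriv v ht).integrable_sub (P := P) y
  have i2 := (heatBounded_inner_sq_mul_heatKernel v ht).integrable_sub (P := P) y
  -- Cauchy–Schwarz in the form of a nonnegative quadratic: the integrand is `(⟨y-u,v⟩/(2t) + a/p)²`
  -- times the kernel, and `a/p` is the optimal shift.
  have h : 0 ≤ ∫ u, ((inner ℝ (y - u) v / (2 * t)) ^ 2 * heatKernel t (y - u)
      - (2 * (a / p)) * heatKernelDeriv v t (y - u)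
      + (a / p) ^ 2 * heatKernel t (y - u)) ∂P := by
    refine integral_nonneg fun u => ?_
    have : (inner ℝ (y - u) v / (2 * t)) ^ 2 * heatKernel t (y - u)
        - (2 * (a / p)) * heatKernelDeriv v t (y - u) + (a / p) ^ 2 * heatKernel t (y - u) =
        (inner ℝ (y - u) v / (2 * t) + a / p) ^ 2 * heatKernel t (y - u) := by
      unfold heatKernelDeriv; ring
    simp only [Pi.zero_apply]
    rw [this]
    exact mul_nonneg (sq_nonneg _) (heatKernel_pos ht _).le
  rw [integral_add (by exact i2.sub (i1.const_mul _)) (i0.const_mul _),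
    integral_sub i2 (i1.const_mul _), integral_const_mul, integral_const_mul] at h
  change 0 ≤ smoothing P (fun x => (inner ℝ x v / (2 * t)) ^ 2 * heatKernel t x) y
    - 2 * (a / p) * a + (a / p) ^ 2 * p at h
  have e : (a / p) ^ 2 * p = a ^ 2 / p := by field_simp
  have e2 : 2 * (a / p) * a = 2 * (a ^ 2 / p) := by ring
  linarith

end Smoothing

/-! ### De Bruijn's identity for comparable measures. -/

section EntropyDerivative

open Real Filter Topology
open scoped NNReal

variable {E : Type*} [NormedAddCommGroup E] [InnerProductSpace ℝ E] [MeasurableSpace E]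

/-- Two measures with mutually bounded densities. -/
def Comparable (P Q : Measure E) (C : ℝ≥0) : Prop := P ≤ C • Q ∧ Q ≤ C • P

/-- The directional logarithmic derivative of the density of `P` smoothed by the heat kernel. -/
noncomputable def score (P : Measure E) (v : E) (t : ℝ) (y : E) : ℝ :=
  smoothing P (heatKernelDeriv v t) y / smoothing P (heatKernel t) y

variable [BorelSpace E] [FiniteDimensional ℝ E] (P Q : Measure E) [IsProbabilityMeasure P]
  [IsProbabilityMeasure Q]

/-- The relative entropy of the heat-kernel smoothings of two measures. -/
noncomputable def smoothedEntropy (P Q : Measure E) (t : ℝ) : ℝ :=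
  ∫ y, smoothing P (heatKernel t) y *
    (log (smoothing P (heatKernel t) y) - log (smoothing Q (heatKernel t) y))

/-- The relative Fisher information of the heat-kernel smoothings of two measures. -/
noncomputable def smoothedFisher (P Q : Measure E) (t : ℝ) : ℝ :=
  ∫ y, smoothing P (heatKernel t) y *
    ∑ i, (score P (stdOrthonormalBasis ℝ E i) t y - score Q (stdOrthonormalBasis ℝ E i) t y) ^ 2

lemma score_mul_smoothing (v : E) {t : ℝ} (ht : 0 < t) (y : E) :
    smoothing P (heatKernelDeriv v t) y = smoothing P (heatKernel t) y * score P v t y := by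
  have := (smoothing_heatKernel_pos P ht y).ne'
  unfold score; field_simp

lemma continuous_smoothing_heatKernel {t : ℝ} (ht : 0 < t) :
    Continuous (smoothing P (heatKernel t)) :=
  (heatBounded_heatKernel ht).continuous_smoothing P

lemma continuous_score (v : E) {t : ℝ} (ht : 0 < t) : Continuous (score P v t) :=
  ((heatBounded_heatKernelDeriv v ht).continuous_smoothing P).div
    (continuous_smoothing_heatKernel P ht) fun y => (smoothing_heatKernel_pos P ht y).ne'

lemma integrable_mul_score_sq (v : E) {t : ℝ} (ht : 0 < t) :
    Integrable fun y => smoothing P (heatKernel t) y * score P v t y ^ 2 := by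
  have h1 := continuous_score P v ht
  have h2 := continuous_smoothing_heatKernel P ht
  refine ((heatBounded_inner_sq_mul_heatKernel v ht).integrable_smoothing P).mono'
    (Continuous.aestronglyMeasurable (by fun_prop)) (ae_of_all _ fun y => ?_)
  have hp := smoothing_heatKernel_pos P ht y
  rw [norm_of_nonneg (by positivity)]
  refine le_of_eq_of_le ?_ (smoothing_heatKernelDeriv_sq_le P v ht y)
  unfold score; field_simp

section

variable {P Q} {C : ℝ≥0} (hC : Comparable P Q C)
include hC

lemma Comparable.smoothing_le {t : ℝ} (ht : 0 < t) (y : E) :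
    smoothing P (heatKernel t) y ≤ C * smoothing Q (heatKernel t) y :=
  smoothing_le_of_le_smul (heatBounded_heatKernel ht) (fun x => (heatKernel_pos ht x).le) hC.1 y

lemma Comparable.symm : Comparable Q P C := ⟨hC.2, hC.1⟩

lemma Comparable.pos : 0 < (C : ℝ) := by
  have h1 := hC.smoothing_le one_pos 0
  have h2 := smoothing_heatKernel_pos P one_pos 0
  have h3 := smoothing_heatKernel_pos Q one_pos 0
  by_contra h
  nlinarith

lemma Comparable.log_sub_log_le {t : ℝ} (ht : 0 < t) (y : E) :
    log (smoothing P (heatKernel t) y) - log (smoothing Q (heatKernel t) y) ≤ log C := by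
  have h2 := smoothing_heatKernel_pos P ht y
  have h3 := smoothing_heatKernel_pos Q ht y
  have := log_le_log h2 (hC.smoothing_le ht y)
  rw [log_mul hC.pos.ne' h3.ne'] at this
  linarith

lemma Comparable.abs_log_sub_log_le {t : ℝ} (ht : 0 < t) (y : E) :
    |log (smoothing P (heatKernel t) y) - log (smoothing Q (heatKernel t) y)| ≤ log C :=
  abs_le.2 ⟨by linarith [hC.symm.log_sub_log_le ht y], hC.log_sub_log_le ht y⟩

lemma Comparable.ratio_le {t : ℝ} (ht : 0 < t) (y : E) :
    |smoothing P (heatKernel t) y / smoothing Q (heatKernel t) y| ≤ C := by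
  have h2 := smoothing_heatKernel_pos P ht y
  have h3 := smoothing_heatKernel_pos Q ht y
  rw [abs_of_pos (by positivity), div_le_iff₀ h3]
  exact hC.smoothing_le ht y

lemma Comparable.continuous_log_sub_log {t : ℝ} (ht : 0 < t) :
    Continuous fun y =>
      log (smoothing P (heatKernel t) y) - log (smoothing Q (heatKernel t) y) :=
  ((continuous_smoothing_heatKernel P ht).log fun y => (smoothing_heatKernel_pos P ht y).ne').sub
    ((continuous_smoothing_heatKernel Q ht).log fun y => (smoothing_heatKernel_pos Q ht y).ne')

lemma Comparable.integrable_mul_score_sq (v : E) {t : ℝ} (ht : 0 < t) :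
    Integrable fun y => smoothing P (heatKernel t) y * score Q v t y ^ 2 := by
  have h1 := continuous_score Q v ht
  have h2 := continuous_smoothing_heatKernel P ht
  refine ((_root_.integrable_mul_score_sq Q v ht).const_mul (C : ℝ)).mono'
    (Continuous.aestronglyMeasurable (by fun_prop)) (ae_of_all _ fun y => ?_)
  have hp := smoothing_heatKernel_pos P ht y
  rw [norm_of_nonneg (by positivity), ← mul_assoc]
  gcongr
  exact hC.smoothing_le ht y

lemma Comparable.integrable_mul_score_mul_score (v : E) {t : ℝ} (ht : 0 < t) :
    Integrable fun y => smoothing P (heatKernel t) y * (score P v t y * score Q v t y) := by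
  have h1 := continuous_score Q v ht
  have h1' := continuous_score P v ht
  have h2 := continuous_smoothing_heatKernel P ht
  refine ((_root_.integrable_mul_score_sq P v ht).add (hC.integrable_mul_score_sq v ht)).mono'
    (Continuous.aestronglyMeasurable (by fun_prop)) (ae_of_all _ fun y => ?_)
  have hp := smoothing_heatKernel_pos P ht y
  simp only [Pi.add_apply]
  rw [norm_mul, norm_of_nonneg hp.le, norm_eq_abs, ← mul_add]
  gcongr
  rw [abs_le]
  constructor <;> nlinarith [sq_nonneg (score P v t y + score Q v t y),
    sq_nonneg (score P v t y - score Q v t y)]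

end

lemma hasLineDerivAt_smoothing_heatKernel (v : E) {t : ℝ} (ht : 0 < t) (y : E) :
    HasLineDerivAt ℝ (smoothing P (heatKernel t)) (smoothing P (heatKernelDeriv v t) y) y v :=
  hasLineDerivAt_smoothing P (heatBounded_heatKernel ht) (heatBounded_heatKernelDeriv v ht)
    (fun x => hasLineDerivAt_heatKernel ht x v) y

lemma hasLineDerivAt_log_smoothing (v : E) {t : ℝ} (ht : 0 < t) (y : E) :
    HasLineDerivAt ℝ (fun y => log (smoothing P (heatKernel t) y)) (score P v t y) y v := by
  have h := hasLineDerivAt_smoothing_heatKernel P v ht y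
  unfold HasLineDerivAt at h ⊢
  simpa [score] using h.log (smoothing_heatKernel_pos P ht _).ne'

/-- Integration by parts against the second derivatives of a smoothed measure. -/
lemma integral_mul_smoothing_heatKernelDeriv2 (v : E) {t : ℝ} (ht : 0 < t) {g g' : E → ℝ} {B : ℝ}
    (hg : Continuous g) (hB : ∀ y, |g y| ≤ B) (h : ∀ y, HasLineDerivAt ℝ g (g' y) y v)
    (hi : Integrable fun y => g' y * smoothing P (heatKernelDeriv v t) y) :
    ∫ y, g y * smoothing P (heatKernelDeriv2 v t) y =
      -∫ y, g' y * smoothing P (heatKernelDeriv v t) y :=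
  integral_bilinear_hasLineDerivAt_right_eq_neg_left_of_integrable
    (B := ContinuousLinearMap.mul ℝ ℝ) hi
    ((heatBounded_heatKernelDeriv2 v ht).integrable_mul_smoothing P hg hB)
    ((heatBounded_heatKernelDeriv v ht).integrable_mul_smoothing P hg hB)
    (fun x _ => h x) (fun x _ => hasLineDerivAt_smoothing P (heatBounded_heatKernelDeriv v ht)
      (heatBounded_heatKernelDeriv2 v ht) (fun x => hasLineDerivAt_heatKernelDeriv ht x v) x)

variable {P Q} {C : ℝ≥0}

lemma Comparable.integrable_mul_score_sub_sq (hC : Comparable P Q C) (v : E) {t : ℝ} (ht : 0 < t) :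
    Integrable fun y => smoothing P (heatKernel t) y * (score P v t y - score Q v t y) ^ 2 := by
  have := ((_root_.integrable_mul_score_sq P v ht).add (hC.integrable_mul_score_sq v ht)).sub
    ((hC.integrable_mul_score_mul_score v ht).const_mul 2)
  refine this.congr (ae_of_all _ fun y => ?_)
  simp only [Pi.add_apply, Pi.sub_apply]
  ring

/-- The factors `log p - log q + 1` and `-p/q` are the partial derivatives of `p log(p/q)` in `p`
and `q`. Moving one derivative onto each gives `-p s_P (s_P - s_Q)` and `p (s_P - s_Q) s_Q`, with
`s` the scores, and these add up to minus a square. Comparability keeps both factors bounded. -/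
lemma Comparable.integral_secondDeriv (hC : Comparable P Q C) (v : E) {t : ℝ} (ht : 0 < t) :
    ∫ y, ((log (smoothing P (heatKernel t) y) - log (smoothing Q (heatKernel t) y) + 1) *
        smoothing P (heatKernelDeriv2 v t) y -
      smoothing P (heatKernel t) y / smoothing Q (heatKernel t) y *
        smoothing Q (heatKernelDeriv2 v t) y) =
      -∫ y, smoothing P (heatKernel t) y * (score P v t y - score Q v t y) ^ 2 := by
  have ip := _root_.integrable_mul_score_sq P v ht
  have iq := hC.integrable_mul_score_sq v ht
  have ipq := hC.integrable_mul_score_mul_score v ht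
  have c1 : Continuous fun y =>
      log (smoothing P (heatKernel t) y) - log (smoothing Q (heatKernel t) y) + 1 :=
    (hC.continuous_log_sub_log ht).add_const 1
  have c2 : Continuous fun y => smoothing P (heatKernel t) y / smoothing Q (heatKernel t) y :=
    (continuous_smoothing_heatKernel P ht).div (continuous_smoothing_heatKernel Q ht)
      fun y => (smoothing_heatKernel_pos Q ht y).ne'
  have b1 : ∀ y, |log (smoothing P (heatKernel t) y) - log (smoothing Q (heatKernel t) y) + 1| ≤
      log C + 1 := fun y => (abs_add_le _ _).trans (by
        rw [abs_one]; linarith [hC.abs_log_sub_log_le ht y])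
  have b2 := hC.ratio_le ht
  have i1 : Integrable fun y => (score P v t y - score Q v t y) *
      smoothing P (heatKernelDeriv v t) y := by
    refine (ip.sub ipq).congr (ae_of_all _ fun y => ?_)
    simp only [Pi.sub_apply]
    rw [score_mul_smoothing P v ht]
    ring
  have i2 : Integrable fun y => (smoothing P (heatKernel t) y / smoothing Q (heatKernel t) y *
      (score P v t y - score Q v t y)) * smoothing Q (heatKernelDeriv v t) y := by
    refine (ipq.sub iq).congr (ae_of_all _ fun y => ?_)
    simp only [Pi.sub_apply]
    rw [score_mul_smoothing Q v ht]
    have := (smoothing_heatKernel_pos Q ht y).ne'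
    field_simp
  have e1 := integral_mul_smoothing_heatKernelDeriv2 P v ht c1 b1
    (g' := fun y => score P v t y - score Q v t y) (fun y => by
      have h1 := hasLineDerivAt_log_smoothing P v ht y
      have h2 := hasLineDerivAt_log_smoothing Q v ht y
      unfold HasLineDerivAt at h1 h2 ⊢
      exact (h1.sub h2).add_const 1) i1
  have e2 := integral_mul_smoothing_heatKernelDeriv2 Q v ht c2 b2
    (g' := fun y => smoothing P (heatKernel t) y / smoothing Q (heatKernel t) y *
      (score P v t y - score Q v t y)) (fun y => by
      have h1 := hasLineDerivAt_smoothing_heatKernel P v ht y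
      have h2 := hasLineDerivAt_smoothing_heatKernel Q v ht y
      have := (smoothing_heatKernel_pos Q ht y).ne'
      have h3 := (smoothing_heatKernel_pos P ht y).ne'
      unfold HasLineDerivAt at h1 h2 ⊢
      refine (h1.fun_div h2 (by simpa using this)).congr_deriv ?_
      simp only [zero_smul, add_zero, score]
      field_simp) i2
  rw [integral_sub ((heatBounded_heatKernelDeriv2 v ht).integrable_mul_smoothing P c1 b1)
    ((heatBounded_heatKernelDeriv2 v ht).integrable_mul_smoothing Q c2 b2), e1, e2,
    sub_neg_eq_add, neg_add_eq_sub, ← neg_sub, ← integral_sub i1 i2]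
  congr 2
  ext y
  rw [score_mul_smoothing P v ht, score_mul_smoothing Q v ht]
  have := (smoothing_heatKernel_pos Q ht y).ne'
  field_simp

/-- De Bruijn's identity for the relative entropy. -/
theorem Comparable.hasDerivAt_smoothedEntropy (hC : Comparable P Q C) {t : ℝ} (ht : 0 < t) :
    HasDerivAt (smoothedEntropy P Q) (-smoothedFisher P Q t) t := by
  obtain ⟨C₁, hC₁, h₁⟩ := exists_smoothing_heatKernelTimeDeriv_le P ht
  obtain ⟨C₂, hC₂, h₂⟩ := exists_smoothing_heatKernelTimeDeriv_le Q ht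
  have ht4 : 0 < 4 * t := by positivity
  have hpos : ∀ s ∈ Set.Ioo (t / 2) (2 * t), 0 < s := fun s hs => by linarith [hs.1]
  -- The time derivative of the entropy density by the chain rule. Near `t` it is dominated by
  -- kernels at time `4t`, since its two coefficients are bounded by `log C + 1` and `C`.
  set F' : ℝ → E → ℝ := fun s y =>
    (log (smoothing P (heatKernel s) y) - log (smoothing Q (heatKernel s) y) + 1) *
        smoothing P (heatKernelTimeDeriv s) y -
      smoothing P (heatKernel s) y / smoothing Q (heatKernel s) y *
        smoothing Q (heatKernelTimeDeriv s) y with hF'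
  have c0 := continuous_smoothing_heatKernel P ht
  have c0' := continuous_smoothing_heatKernel Q ht
  have c1 := hC.continuous_log_sub_log ht
  have c2 := (heatBounded_heatKernelTimeDeriv ht).continuous_smoothing (P := P)
  have c3 := (heatBounded_heatKernelTimeDeriv ht).continuous_smoothing (P := Q)
  have c4 : Continuous fun y => smoothing P (heatKernel t) y / smoothing Q (heatKernel t) y :=
    c0.div c0' fun y => (smoothing_heatKernel_pos Q ht y).ne'
  have key := (hasDerivAt_integral_of_dominated_loc_of_deriv_le (μ := (volume : Measure E))
    (𝕜 := ℝ) (x₀ := t)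
    (F := fun s y => smoothing P (heatKernel s) y *
      (log (smoothing P (heatKernel s) y) - log (smoothing Q (heatKernel s) y))) (F' := F')
    (bound := fun y => (log C + 1) * (C₁ * smoothing P (heatKernel (4 * t)) y) +
      C * (C₂ * smoothing Q (heatKernel (4 * t)) y))
    (Ioo_mem_nhds (show t / 2 < t by linarith) (show t < 2 * t by linarith))
    ?_ ?_ ?_ (ae_of_all _ fun y s hs => ?_) ?_ (ae_of_all _ fun y s hs => ?_)).2
  · unfold smoothedEntropy
    refine key.congr_deriv ?_
    -- The heat equation replaces time derivatives by sums of second directional derivatives, ready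
    -- for integration by parts one direction at a time.
    have e : ∀ y, F' t y = ∑ i,
        ((log (smoothing P (heatKernel t) y) - log (smoothing Q (heatKernel t) y) + 1) *
          smoothing P (heatKernelDeriv2 (stdOrthonormalBasis ℝ E i) t) y -
        smoothing P (heatKernel t) y / smoothing Q (heatKernel t) y *
          smoothing Q (heatKernelDeriv2 (stdOrthonormalBasis ℝ E i) t) y) := by
      intro y
      rw [Finset.sum_sub_distrib, ← Finset.mul_sum, ← Finset.mul_sum,
        sum_smoothing_heatKernelDeriv2 P _ ht, sum_smoothing_heatKernelDeriv2 Q _ ht]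
    rw [integral_congr_ae (ae_of_all _ e), integral_finsetSum]
    · simp_rw [hC.integral_secondDeriv _ ht]
      rw [Finset.sum_neg_distrib, ← integral_finsetSum _
        fun i _ => hC.integrable_mul_score_sub_sq _ ht]
      unfold smoothedFisher
      simp_rw [Finset.mul_sum]
    · intro i _
      exact ((heatBounded_heatKernelDeriv2 _ ht).integrable_mul_smoothing P (c1.add_const 1)
        (B := log C + 1) (fun y => (abs_add_le _ _).trans (by
          rw [abs_one]; linarith [hC.abs_log_sub_log_le ht y]))).sub
        ((heatBounded_heatKernelDeriv2 _ ht).integrable_mul_smoothing Q c4 (hC.ratio_le ht))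
  · filter_upwards [Ioi_mem_nhds ht] with s hs
    have := hC.continuous_log_sub_log hs
    have := continuous_smoothing_heatKernel P hs
    exact Continuous.aestronglyMeasurable (by fun_prop)
  · simp_rw [mul_comm (smoothing P (heatKernel t) _)]
    exact (heatBounded_heatKernel ht).integrable_mul_smoothing P c1 (hC.abs_log_sub_log_le ht)
  · exact Continuous.aestronglyMeasurable (by fun_prop)
  · have hs0 := hpos s hs
    have hl := hC.abs_log_sub_log_le hs0 y
    rw [hF']
    refine (norm_sub_le _ _).trans ?_
    rw [norm_mul, norm_mul]
    gcongr
    · linarith [abs_nonneg (log (smoothing P (heatKernel s) y) - log (smoothing Q (heatKernel s) y))]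
    · refine (norm_add_le _ _).trans ?_
      rw [norm_one]
      gcongr
      exact hl
    · exact h₁ s hs y
    · exact hC.ratio_le hs0 y
    · exact h₂ s hs y
  · exact ((((heatBounded_heatKernel ht4).integrable_smoothing P).const_mul _).const_mul _).add
      ((((heatBounded_heatKernel ht4).integrable_smoothing Q).const_mul _).const_mul _)
  · have hs0 := hpos s hs
    have hp := smoothing_heatKernel_pos P hs0 y
    have hq := smoothing_heatKernel_pos Q hs0 y
    have d1 := hasDerivAt_smoothing_heatKernel P hs0 y
    have d2 := hasDerivAt_smoothing_heatKernel Q hs0 y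
    refine (d1.mul ((d1.log hp.ne').fun_sub (d2.log hq.ne'))).congr_deriv ?_
    rw [hF']
    field_simp
    ring

end EntropyDerivative

/-! ### Variational characterisation of relative entropy. -/

section Duality

open Real Filter Topology
open scoped NNReal

variable {α : Type*} [MeasurableSpace α]

/-- Young's inequality for the convex pair `klFun` and `exp - 1`; for `h > 0` it is `1 + x ≤ exp x`
at `x = g - log h`. -/
lemma mul_sub_exp_add_one_le_klFun {h : ℝ} (hh : 0 ≤ h) (g : ℝ) :
    h * g - (exp g - 1) ≤ klFun h := by
  rcases hh.eq_or_lt with rfl | hh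
  · rw [klFun_zero]; linarith [exp_pos g, zero_mul g]
  · have h1 := add_one_le_exp (g - log h)
    rw [exp_sub, exp_log hh, le_div_iff₀ hh] at h1
    rw [klFun_apply]
    linarith

/-- With `c` the clamped value, `(h - c) log c ≥ 0` because clamping to `[1/k, k]` makes both
factors have the same sign, and the rest is `klFun c ≥ 0`. This sign is what makes Fatou's lemma
applicable to the truncated test functions. -/
lemma mul_log_sub_nonneg_of_clamp {h k : ℝ} (hh : 0 ≤ h) (hk : 1 ≤ k) :
    0 ≤ h * log (max k⁻¹ (min h k)) - (max k⁻¹ (min h k) - 1) := by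
  have hk0 : 0 < k := by linarith
  have hki : 0 < k⁻¹ := by positivity
  have hki1 : k⁻¹ ≤ 1 := inv_le_one_of_one_le₀ hk
  have key : ∀ c : ℝ, 0 < c → 0 ≤ c * log c - (c - 1) := fun c hc => by
    have := klFun_nonneg hc.le
    rw [klFun_apply] at this; linarith
  rcases le_total h k with h1 | h1
  · rw [min_eq_left h1]
    rcases le_total k⁻¹ h with h2 | h2
    · rw [max_eq_right h2]; exact key h (by linarith)
    · rw [max_eq_left h2]
      have h3 : log k⁻¹ ≤ 0 := log_nonpos hki.le hki1
      nlinarith [key _ hki]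
  · rw [min_eq_right h1, max_eq_right (hki1.trans hk)]
    have h3 : 0 ≤ log k := log_nonneg hk
    nlinarith [key _ hk0]

lemma tendsto_clamp {h : ℝ} (hh : 0 ≤ h) :
    Tendsto (fun k : ℕ => max ((k : ℝ) + 1)⁻¹ (min h (k + 1))) atTop (𝓝 h) := by
  have h1 : Tendsto (fun k : ℕ => ((k : ℝ) + 1)⁻¹) atTop (𝓝 0) := by
    simpa using tendsto_one_div_add_atTop_nhds_zero_nat (𝕜 := ℝ)
  have h2 : Tendsto (fun k : ℕ => min h ((k : ℝ) + 1)) atTop (𝓝 h) := by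
    refine tendsto_const_nhds.congr' ?_
    filter_upwards [eventually_ge_atTop ⌈h⌉₊] with k hk
    rw [min_eq_left]
    have := Nat.ceil_le.1 hk
    linarith
  simpa [max_eq_right hh] using h1.max h2

/-- At `h = 0` the logarithm diverges but is multiplied by `0`, and the remaining term tends to `1 =
klFun 0`. -/
lemma tendsto_mul_log_clamp {h : ℝ} (hh : 0 ≤ h) :
    Tendsto (fun k : ℕ => h * log (max ((k : ℝ) + 1)⁻¹ (min h (k + 1))) -
      (max ((k : ℝ) + 1)⁻¹ (min h (k + 1)) - 1)) atTop (𝓝 (klFun h)) := by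
  have h1 := tendsto_clamp hh
  rcases hh.eq_or_lt with rfl | hpos
  · rw [klFun_zero]
    simpa using (h1.sub_const 1).neg
  · have := ((h1.log hpos.ne').const_mul h).sub (h1.sub_const 1)
    rw [klFun_apply]
    convert this using 2
    ring

/-- The functional whose supremum over bounded functions `g` is the relative entropy. -/
noncomputable def klDual (P Q : Measure α) (g : α → ℝ) : ℝ :=
  ∫ x, g x ∂P - ∫ x, (exp (g x) - 1) ∂Q

variable {P Q : Measure α} [IsProbabilityMeasure P] [IsProbabilityMeasure Q]

lemma integrable_exp_sub_one {g : α → ℝ} (hg : Measurable g) {B : ℝ} (hB : ∀ x, |g x| ≤ B)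
    (R : Measure α) [IsFiniteMeasure R] : Integrable (fun x => exp (g x) - 1) R := by
  refine .of_bound (by fun_prop) (exp B + 1) (ae_of_all _ fun x => ?_)
  refine (norm_sub_le _ _).trans ?_
  rw [norm_one, norm_of_nonneg (exp_pos _).le]
  gcongr
  exact (le_abs_self _).trans (hB x)

lemma integrable_of_abs_le {g : α → ℝ} (hg : Measurable g) {B : ℝ} (hB : ∀ x, |g x| ≤ B)
    (R : Measure α) [IsFiniteMeasure R] : Integrable g R :=
  .of_bound hg.aestronglyMeasurable B (ae_of_all _ hB)

lemma integral_eq_integral_rnDeriv_mul (hac : P ≪ Q) (g : α → ℝ) :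
    ∫ x, g x ∂P = ∫ x, (P.rnDeriv Q x).toReal * g x ∂Q := by
  simpa using (integral_rnDeriv_smul hac (f := g)).symm

lemma klDual_le_klDiv {g : α → ℝ} (hg : Measurable g) {B : ℝ} (hB : ∀ x, |g x| ≤ B) :
    ENNReal.ofReal (klDual P Q g) ≤ klDiv P Q := by
  by_cases htop : klDiv P Q = ∞
  · simp [htop]
  obtain ⟨hac, hint⟩ := klDiv_ne_top_iff.1 htop
  refine ENNReal.ofReal_le_of_le_toReal ?_
  rw [toReal_klDiv_eq_integral_klFun hac, klDual, integral_eq_integral_rnDeriv_mul hac]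
  have i1 : Integrable (fun x => (P.rnDeriv Q x).toReal * g x) Q := by
    simpa using (integrable_rnDeriv_smul_iff hac (f := g)).2 (integrable_of_abs_le hg hB P)
  have i2 := integrable_exp_sub_one hg hB Q
  rw [← integral_sub i1 i2]
  exact integral_mono (i1.sub i2) ((integrable_klFun_rnDeriv_iff hac).2 hint)
    fun x => mul_sub_exp_add_one_le_klFun ENNReal.toReal_nonneg _

/-- Large multiples of indicators of `Q`-null sets force `P ≪ Q`. The optimal test function, the
logarithm of the density, is then approached by logarithms of clamped densities, and Fatou's lemma
concludes. -/
lemma klDiv_le_of_klDual_measurable {M : ℝ}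
    (h : ∀ g : α → ℝ, Measurable g → (∃ B, ∀ x, |g x| ≤ B) → klDual P Q g ≤ M) :
    klDiv P Q ≤ ENNReal.ofReal M := by
  have hac : P ≪ Q := by
    refine Measure.AbsolutelyContinuous.mk fun A hA hQA => ?_
    have h1 : ∀ c : ℝ, 0 ≤ c → c * P.real A ≤ M := by
      intro c hc
      have := h (A.indicator fun _ => c) (measurable_const.indicator hA)
        ⟨c, fun x => by
          by_cases hx : x ∈ A
          · simp [hx, abs_of_nonneg hc]
          · simpa [hx] using hc⟩
      rw [klDual, integral_indicator_const c hA] at this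
      have h2 : ∫ x, (exp (A.indicator (fun _ => c) x) - 1) ∂Q = 0 := by
        refine integral_eq_zero_of_ae ?_
        filter_upwards [measure_eq_zero_iff_ae_notMem.1 hQA] with x hx
        simp [hx]
      rw [h2, smul_eq_mul, sub_zero, mul_comm] at this
      exact this
    by_contra hP
    have hpos : 0 < P.real A := by
      rw [measureReal_def]
      exact ENNReal.toReal_pos hP (measure_ne_top _ _)
    have hM : 0 ≤ M := by simpa using h1 0 le_rfl
    -- This height makes the dual functional equal to `M + 1`.
    have := h1 ((M + 1) / P.real A) (by positivity)
    rw [div_mul_cancel₀ _ hpos.ne'] at this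
    linarith
  rw [klDiv_eq_lintegral_klFun_of_ac hac]
  set f := fun x => (P.rnDeriv Q x).toReal with hf
  have hfm : Measurable f := (Measure.measurable_rnDeriv P Q).ennreal_toReal
  set c : ℕ → α → ℝ := fun k x => max ((k : ℝ) + 1)⁻¹ (min (f x) (k + 1)) with hc
  have hcm : ∀ k, Measurable (c k) := fun k => by
    rw [hc]; exact measurable_const.max (hfm.min measurable_const)
  have hcpos : ∀ k x, 0 < c k x := fun k x => lt_max_of_lt_left (by positivity)
  have hbound : ∀ k x, |log (c k x)| ≤ log ((k : ℝ) + 1) := by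
    intro k x
    have hk : (0:ℝ) < (k : ℝ) + 1 := by positivity
    rw [abs_le, ← log_inv]
    refine ⟨log_le_log (by positivity) (le_max_left _ _), log_le_log (hcpos k x) ?_⟩
    refine max_le ?_ (min_le_right _ _)
    have : (1:ℝ) ≤ (k : ℝ) + 1 := by linarith [Nat.cast_nonneg (α := ℝ) k]
    exact (inv_le_one_of_one_le₀ this).trans this
  have hint : ∀ k, ∫⁻ x, ENNReal.ofReal (f x * log (c k x) - (c k x - 1)) ∂Q ≤
      ENNReal.ofReal M := by
    intro k
    have h1 := h (fun x => log (c k x)) (hcm k).log ⟨_, hbound k⟩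
    have i1 : Integrable (fun x => f x * log (c k x)) Q := by
      simpa using (integrable_rnDeriv_smul_iff hac (f := fun x => log (c k x))).2
        (integrable_of_abs_le (hcm k).log (hbound k) P)
    have i2 := integrable_exp_sub_one (hcm k).log (hbound k) Q
    rw [klDual, integral_eq_integral_rnDeriv_mul hac, ← integral_sub i1 i2] at h1
    simp_rw [exp_log (hcpos k _)] at h1 i2
    have i3 : Integrable (fun x => f x * log (c k x) - (c k x - 1)) Q := i1.sub i2
    rw [← ofReal_integral_eq_lintegral_ofReal i3 (ae_of_all _ fun x =>
      mul_log_sub_nonneg_of_clamp ENNReal.toReal_nonneg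
        (by linarith [Nat.cast_nonneg (α := ℝ) k]))]
    exact ENNReal.ofReal_le_ofReal h1
  calc ∫⁻ x, ENNReal.ofReal (klFun (f x)) ∂Q
      = ∫⁻ x, liminf (fun k => ENNReal.ofReal (f x * log (c k x) - (c k x - 1))) atTop ∂Q := by
        refine lintegral_congr fun x => ?_
        exact (((ENNReal.continuous_ofReal.tendsto _).comp
          (tendsto_mul_log_clamp (h := f x) ENNReal.toReal_nonneg)).liminf_eq).symm
    _ ≤ liminf (fun k => ∫⁻ x, ENNReal.ofReal (f x * log (c k x) - (c k x - 1)) ∂Q) atTop :=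
        lintegral_liminf_le fun k => by
          have := hcm k
          fun_prop
    _ ≤ ENNReal.ofReal M := by
        refine (liminf_le_liminf (v := fun _ => ENNReal.ofReal M) (.of_forall hint)).trans ?_
        simp

/-- Bounded continuous functions are dense in `L¹(P + Q)`. Clamping the approximant to `[-B, B]`
does not worsen it and makes `exp` Lipschitz with constant `exp B` on the relevant range. -/
lemma klDual_measurable_le_of_continuous [PseudoMetricSpace α] [BorelSpace α] {M : ℝ}
    (h : ∀ g : α → ℝ, Continuous g → (∃ B, ∀ x, |g x| ≤ B) → klDual P Q g ≤ M)
    {g : α → ℝ} (hg : Measurable g) {B : ℝ} (hB : ∀ x, |g x| ≤ B) : klDual P Q g ≤ M := by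
  have hB0 : 0 ≤ B := by
    obtain ⟨x⟩ := nonempty_of_isProbabilityMeasure P
    exact (abs_nonneg _).trans (hB x)
  refine le_of_forall_pos_le_add fun ε hε => ?_
  -- The error is at most `δ_P + exp B * δ_Q`, with `δ` the two `L¹` distances, hence at most `(1 +
  -- exp B)(δ_P + δ_Q) ≤ ε`.
  obtain ⟨f, hf, -⟩ := (integrable_of_abs_le hg hB (P + Q)).exists_boundedContinuous_integral_sub_le
    (ε := ε / (1 + exp B)) (by positivity)
  set f' : α → ℝ := fun x => max (-B) (min (f x) B) with hf'
  have hfc : Continuous f' := by have := f.continuous; fun_prop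
  have hfB : ∀ x, |f' x| ≤ B := fun x =>
    abs_le.2 ⟨le_max_left _ _, max_le (by linarith) (min_le_right _ _)⟩
  have hclose : ∀ x, |g x - f' x| ≤ |g x - f x| := by
    intro x
    have hx := abs_le.1 (hB x)
    have h1 : g x = max (-B) (min (g x) B) := by rw [min_eq_left hx.2, max_eq_right hx.1]
    calc |g x - f' x| = |max (-B) (min (g x) B) - max (-B) (min (f x) B)| := by rw [← h1]
      _ ≤ |min (g x) B - min (f x) B| := by
        simpa using abs_max_sub_max_le_max (-B) (min (g x) B) (-B) (min (f x) B)
      _ ≤ |g x - f x| := by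
        simpa using abs_min_sub_min_le_max (g x) B (f x) B
  have hi : ∀ R : Measure α, [IsFiniteMeasure R] → Integrable (fun x => |g x - f x|) R :=
    fun R _ => ((integrable_of_abs_le hg hB R).sub (f.integrable R)).abs
  have h1 : ∫ x, g x ∂P ≤ ∫ x, f' x ∂P + ∫ x, |g x - f x| ∂P := by
    rw [← integral_add (integrable_of_abs_le hfc.measurable hfB P) (hi P)]
    refine integral_mono (integrable_of_abs_le hg hB P)
      ((integrable_of_abs_le hfc.measurable hfB P).add (hi P)) fun x => ?_
    linarith [le_abs_self (g x - f' x), hclose x]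
  have h2 : ∫ x, (exp (f' x) - 1) ∂Q ≤
      ∫ x, (exp (g x) - 1) ∂Q + exp B * ∫ x, |g x - f x| ∂Q := by
    rw [← integral_const_mul, ← integral_add (integrable_exp_sub_one hg hB Q)
      ((hi Q).const_mul _)]
    refine integral_mono (integrable_exp_sub_one hfc.measurable hfB Q)
      ((integrable_exp_sub_one hg hB Q).add ((hi Q).const_mul _)) fun x => ?_
    have e1 := add_one_le_exp (g x - f' x)
    rw [exp_sub, le_div_iff₀ (exp_pos _)] at e1
    have e2 : exp (f' x) ≤ exp B := exp_le_exp.2 ((le_abs_self _).trans (hfB x))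
    have e3 : exp (f' x) * (f' x - g x) ≤ exp B * |g x - f x| := by
      refine (mul_le_mul_of_nonneg_left (le_abs_self _) (exp_pos _).le).trans ?_
      rw [abs_sub_comm]
      exact mul_le_mul e2 (hclose x) (abs_nonneg _) (exp_pos _).le
    linarith
  have h3 := h f' hfc ⟨B, hfB⟩
  simp only [norm_eq_abs] at hf
  rw [integral_add_measure (hi P) (hi Q), le_div_iff₀ (by positivity)] at hf
  have h4 : 0 ≤ ∫ x, |g x - f x| ∂P := integral_nonneg fun x => abs_nonneg _
  have h5 : 0 ≤ ∫ x, |g x - f x| ∂Q := integral_nonneg fun x => abs_nonneg _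
  unfold klDual at h3 ⊢
  nlinarith [exp_pos B, mul_nonneg h4 (exp_pos B).le]

/-- The variational formula for the relative entropy, with bounded continuous test functions. -/
theorem klDiv_le_of_klDual [PseudoMetricSpace α] [BorelSpace α] {M : ℝ}
    (h : ∀ g : α → ℝ, Continuous g → (∃ B, ∀ x, |g x| ≤ B) → klDual P Q g ≤ M) :
    klDiv P Q ≤ ENNReal.ofReal M :=
  klDiv_le_of_klDual_measurable fun _ hg ⟨_, hB⟩ => klDual_measurable_le_of_continuous h hg hB

end Duality

/-! ### The smoothed entropy as the noise level tends to infinity and to zero. -/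

section EntropyLimits

open Real Filter Topology
open scoped NNReal

variable {E : Type*} [NormedAddCommGroup E] [InnerProductSpace ℝ E] [MeasurableSpace E]
  [BorelSpace E] [FiniteDimensional ℝ E]

lemma integral_mul_heatKernel {t : ℝ} (ht : 0 < t) {f : E → ℝ} (hf : Measurable f) :
    ∫ x, f x * heatKernel t x = ∫ z, f (√(2 * t) • z) ∂stdGaussian E := by
  have h := (continuous_heatKernel (E := E) t).measurable
  have e : ∫ z, f (√(2 * t) • z) ∂stdGaussian E =
      ∫ x, f x ∂((stdGaussian E).map fun x => √(2 * t) • x) := by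
    rw [integral_map (by fun_prop) hf.aestronglyMeasurable]
  rw [e, map_smul_stdGaussian ht, integral_withDensity_eq_integral_toReal_smul (by fun_prop)
    (by simp)]
  refine integral_congr_ae (ae_of_all _ fun x => ?_)
  simp only
  rw [ENNReal.toReal_ofReal (heatKernel_pos ht x).le, smul_eq_mul, mul_comm]

/-- Two densities of equal mass have `L¹` distance twice the integral of the positive part.
Factoring out the kernel and rescaling leaves an integrand bounded by `1` against a law that does
not depend on `t`. -/
lemma integral_abs_sub_heatKernel_eq {t : ℝ} (ht : 0 < t) (u : E) :
    ∫ y, |heatKernel t (y - u) - heatKernel t y| =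
      2 * ∫ z, max (1 - exp (-(‖√(2 * t) • z - u‖ ^ 2 - ‖√(2 * t) • z‖ ^ 2) / (4 * t))) 0
        ∂stdGaussian E := by
  have h1 := integrable_heatKernel (E := E) ht
  have h2 : Integrable fun y => heatKernel t (y - u) := h1.comp_sub_right u
  have h3 : Integrable fun y => max (heatKernel t y - heatKernel t (y - u)) 0 :=
    (h1.sub h2).pos_part
  have e : ∀ y, |heatKernel t (y - u) - heatKernel t y| =
      2 * max (heatKernel t y - heatKernel t (y - u)) 0 +
        (heatKernel t (y - u) - heatKernel t y) := by
    intro y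
    rcases le_total (heatKernel t y) (heatKernel t (y - u)) with h | h
    · rw [abs_of_nonneg (by linarith), max_eq_right (by linarith)]; ring
    · rw [abs_of_nonpos (by linarith), max_eq_left (by linarith)]; ring
  simp_rw [e]
  rw [integral_add (h3.const_mul 2) (by exact h2.sub h1), integral_sub h2 h1,
    integral_sub_right_eq_self (fun y => heatKernel t y) u, sub_self, add_zero,
    integral_const_mul, ← integral_mul_heatKernel ht
      (f := fun y => max (1 - exp (-(‖y - u‖ ^ 2 - ‖y‖ ^ 2) / (4 * t))) 0)
      (Continuous.measurable (by fun_prop))]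
  congr 2
  ext y
  rw [max_mul_of_nonneg _ _ (heatKernel_pos ht y).le, zero_mul, sub_mul, one_mul]
  congr 2
  rw [heatKernel, heatKernel, mul_left_comm, ← exp_add]
  congr 2
  ring

lemma tendsto_integral_abs_sub_heatKernel (u : E) :
    Tendsto (fun t => ∫ y, |heatKernel t (y - u) - heatKernel t y|) atTop (𝓝 0) := by
  have key : Tendsto (fun t => ∫ z, max (1 - exp (-(‖√(2 * t) • z - u‖ ^ 2 -
      ‖√(2 * t) • z‖ ^ 2) / (4 * t))) 0 ∂stdGaussian E) atTop (𝓝 (∫ z, 0 ∂stdGaussian E)) := by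
    refine tendsto_integral_filter_of_dominated_convergence (fun _ => 1)
      (.of_forall fun t => Continuous.aestronglyMeasurable (by fun_prop))
      (.of_forall fun t => ae_of_all _ fun z => ?_) (integrable_const 1)
      (ae_of_all _ fun z => ?_)
    · rw [norm_of_nonneg (le_max_right _ _)]
      exact max_le (by linarith [exp_pos (-(‖√(2 * t) • z - u‖ ^ 2 - ‖√(2 * t) • z‖ ^ 2) / (4 * t))])
        zero_le_one
    · have h1 : Tendsto (fun t : ℝ => (√(2 * t))⁻¹) atTop (𝓝 0) :=
        tendsto_inv_atTop_zero.comp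
          (tendsto_sqrt_atTop.comp (tendsto_id.const_mul_atTop (by norm_num)))
      have h2 : Tendsto (fun t : ℝ => t⁻¹) atTop (𝓝 0) := tendsto_inv_atTop_zero
      -- The expanded exponent: a fixed shift `u` is negligible against noise of size `√t`.
      have h3 : Tendsto (fun t : ℝ => (√(2 * t))⁻¹ * inner ℝ z u - t⁻¹ * (‖u‖ ^ 2 / 4))
          atTop (𝓝 0) := by
        simpa using (h1.mul_const (inner ℝ z u)).sub (h2.mul_const (‖u‖ ^ 2 / 4))
      have h4 : Tendsto (fun t : ℝ => -(‖√(2 * t) • z - u‖ ^ 2 - ‖√(2 * t) • z‖ ^ 2) / (4 * t))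
          atTop (𝓝 0) := by
        refine h3.congr' ?_
        filter_upwards [eventually_gt_atTop 0] with t ht
        have hs : √(2 * t) ^ 2 = 2 * t := sq_sqrt (by positivity)
        have hs0 : √(2 * t) ≠ 0 := by positivity
        rw [norm_sub_sq_real, real_inner_smul_left]
        have e : (√(2 * t))⁻¹ = √(2 * t) / (2 * t) := by
          rw [eq_div_iff (by positivity), inv_mul_eq_iff_eq_mul₀ hs0, ← sq, hs]
        rw [e]
        field_simp
        ring
      simpa using (((continuous_exp.tendsto 0).comp h4).const_sub 1).max
        (tendsto_const_nhds (x := (0 : ℝ)))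
  have := key.const_mul 2
  simp only [integral_zero, mul_zero] at this
  refine this.congr' ?_
  filter_upwards [eventually_gt_atTop 0] with t ht
  rw [integral_abs_sub_heatKernel_eq ht]

variable (P Q : Measure E) [IsProbabilityMeasure P] [IsProbabilityMeasure Q]

lemma tendsto_integral_integral_abs_sub_heatKernel :
    Tendsto (fun t => ∫ u, (∫ y, |heatKernel t (y - u) - heatKernel t y|) ∂P) atTop
      (𝓝 0) := by
  rw [show (0 : ℝ) = ∫ _, 0 ∂P by simp]
  refine tendsto_integral_filter_of_dominated_convergence (fun _ => 2) ?_ ?_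
    (integrable_const 2) (ae_of_all _ tendsto_integral_abs_sub_heatKernel)
  · filter_upwards with t
    have := continuous_heatKernel (E := E) t
    exact (StronglyMeasurable.integral_prod_right (f := fun u y =>
      |heatKernel t (y - u) - heatKernel t y|)
      (Continuous.stronglyMeasurable (by fun_prop))).aestronglyMeasurable
  · filter_upwards [eventually_gt_atTop 0] with t ht
    refine ae_of_all _ fun u => ?_
    have h1 := integrable_heatKernel (E := E) ht
    have h2 : Integrable fun y => heatKernel t (y - u) := h1.comp_sub_right u
    rw [norm_of_nonneg (integral_nonneg fun y => abs_nonneg _)]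
    calc ∫ y, |heatKernel t (y - u) - heatKernel t y|
        ≤ ∫ y, (heatKernel t (y - u) + heatKernel t y) := by
          refine integral_mono (h2.sub h1).abs (h2.add h1) fun y => ?_
          refine (abs_sub _ _).trans ?_
          rw [abs_of_pos (heatKernel_pos ht _), abs_of_pos (heatKernel_pos ht _)]
      _ = 2 := by
        rw [integral_add h2 h1, integral_sub_right_eq_self (fun y => heatKernel t y) u,
          integral_heatKernel ht]
        norm_num

lemma integral_abs_smoothing_sub_le {t : ℝ} (ht : 0 < t) :
    ∫ y, |smoothing P (heatKernel t) y - heatKernel t y| ≤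
      ∫ u, (∫ y, |heatKernel t (y - u) - heatKernel t y|) ∂P := by
  have hb := heatBounded_heatKernel (E := E) ht
  have i1 := hb.integrable_prod_sub P (g := fun _ => 1) continuous_const (B := 1) (by simp)
  have i2 := (integrable_const (1 : ℝ) (μ := P)).mul_prod hb.integrable
  simp only [one_mul] at i1 i2
  have i3 : Integrable (fun z : E × E => |heatKernel t (z.2 - z.1) - heatKernel t z.2|)
      (P.prod volume) := (i1.sub i2).abs
  rw [integral_integral_swap (f := fun u y => |heatKernel t (y - u) - heatKernel t y|) i3]
  refine integral_mono ((hb.integrable_smoothing P).sub hb.integrable).abs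
    i3.integral_prod_right fun y => ?_
  have : smoothing P (heatKernel t) y - heatKernel t y =
      ∫ u, (heatKernel t (y - u) - heatKernel t y) ∂P := by
    rw [integral_sub (hb.integrable_sub y) (integrable_const _)]
    simp [smoothing]
  rw [this]
  exact abs_integral_le_integral_abs

lemma tendsto_integral_abs_smoothing_sub :
    Tendsto (fun t => ∫ y, |smoothing P (heatKernel t) y - smoothing Q (heatKernel t) y|)
      atTop (𝓝 0) := by
  refine squeeze_zero' (.of_forall fun t => integral_nonneg fun y => abs_nonneg _) ?_
    (by
      simpa only [add_zero] using (tendsto_integral_integral_abs_sub_heatKernel P).add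
        (tendsto_integral_integral_abs_sub_heatKernel Q))
  filter_upwards [eventually_gt_atTop 0] with t ht
  have hb := heatBounded_heatKernel (E := E) ht
  have iP : Integrable fun y => |smoothing P (heatKernel t) y - heatKernel t y| :=
    ((hb.integrable_smoothing P).sub hb.integrable).abs
  have iQ : Integrable fun y => |smoothing Q (heatKernel t) y - heatKernel t y| :=
    ((hb.integrable_smoothing Q).sub hb.integrable).abs
  refine le_trans ?_ (add_le_add (integral_abs_smoothing_sub_le P ht)
    (integral_abs_smoothing_sub_le Q ht))
  rw [← integral_add iP iQ]
  refine integral_mono ((hb.integrable_smoothing P).sub (hb.integrable_smoothing Q)).abs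
    (iP.add iQ) fun y => ?_
  rw [abs_sub_comm (smoothing Q (heatKernel t) y)]
  exact abs_sub_le _ _ _

variable {P Q} in
lemma Comparable.integrable_smoothedEntropy {C : ℝ≥0} (hC : Comparable P Q C) {t : ℝ}
    (ht : 0 < t) :
    Integrable fun y => smoothing P (heatKernel t) y *
      (log (smoothing P (heatKernel t) y) - log (smoothing Q (heatKernel t) y)) := by
  simp_rw [mul_comm (smoothing P (heatKernel t) _)]
  exact (heatBounded_heatKernel ht).integrable_mul_smoothing P (hC.continuous_log_sub_log ht)
    (hC.abs_log_sub_log_le ht)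

/-- Young's inequality at `p / q`, multiplied by `q`. The term `q - p` integrates to zero for
probability densities. -/
lemma mul_log_sub_log_ge {p q : ℝ} (hp : 0 < p) (hq : 0 < q) (g : ℝ) :
    g * p - (exp g - 1) * q ≤ p * (log p - log q) + (q - p) := by
  have h := mul_le_mul_of_nonneg_right
    (mul_sub_exp_add_one_le_klFun (h := p / q) (by positivity) g) hq.le
  rw [klFun_apply, log_div hp.ne' hq.ne'] at h
  have e1 : (p / q * g - (exp g - 1)) * q = g * p - (exp g - 1) * q := by field_simp
  have e2 : (p / q * (log p - log q) + 1 - p / q) * q = p * (log p - log q) + (q - p) := by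
    field_simp; ring
  linarith

variable {P Q} in
-- The entropy is nonnegative and at most the symmetrised entropy `∫ (p - q)(log p - log q) ≤ log C
-- · ‖p - q‖₁`, and the `L¹` distance tends to zero.
theorem Comparable.tendsto_smoothedEntropy_atTop {C : ℝ≥0} (hC : Comparable P Q C) :
    Tendsto (smoothedEntropy P Q) atTop (𝓝 0) := by
  refine squeeze_zero' ?_ ?_
    (by simpa using (tendsto_integral_abs_smoothing_sub P Q).const_mul (log C))
  · filter_upwards [eventually_gt_atTop 0] with t ht
    have hb := heatBounded_heatKernel (E := E) ht
    have h : ∫ y, (smoothing P (heatKernel t) y - smoothing Q (heatKernel t) y) = 0 := by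
      rw [integral_sub (hb.integrable_smoothing P) (hb.integrable_smoothing Q),
        integral_smoothing_heatKernel P ht, integral_smoothing_heatKernel Q ht, sub_self]
    rw [← h]
    refine integral_mono ((hb.integrable_smoothing P).sub (hb.integrable_smoothing Q))
      (hC.integrable_smoothedEntropy ht) fun y => ?_
    have := mul_log_sub_log_ge (smoothing_heatKernel_pos P ht y) (smoothing_heatKernel_pos Q ht y) 0
    simp at this
    linarith
  · filter_upwards [eventually_gt_atTop 0] with t ht
    have hb := heatBounded_heatKernel (E := E) ht
    have i1 : Integrable fun y =>
        log C * |smoothing P (heatKernel t) y - smoothing Q (heatKernel t) y| :=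
      ((hb.integrable_smoothing P).sub (hb.integrable_smoothing Q)).abs.const_mul (log C)
    have i2 : Integrable fun y =>
        smoothing P (heatKernel t) y - smoothing Q (heatKernel t) y := (hb.integrable_smoothing P).sub (hb.integrable_smoothing Q)
    have h : ∫ y, (smoothing P (heatKernel t) y - smoothing Q (heatKernel t) y) = 0 := by
      rw [integral_sub (hb.integrable_smoothing P) (hb.integrable_smoothing Q),
        integral_smoothing_heatKernel P ht, integral_smoothing_heatKernel Q ht, sub_self]
    rw [← integral_const_mul, ← add_zero (∫ y, _ * _), ← h, ← integral_add i1 i2]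
    refine integral_mono (hC.integrable_smoothedEntropy ht) (i1.add i2) fun y => ?_
    have hp := smoothing_heatKernel_pos P ht y
    have hq := smoothing_heatKernel_pos Q ht y
    set p := smoothing P (heatKernel t) y
    set q := smoothing Q (heatKernel t) y
    have h1 := mul_log_sub_log_ge hq hp 0
    have h2 : (p - q) * (log p - log q) ≤ |p - q| * log C :=
      (le_abs_self _).trans (by
        rw [abs_mul]
        exact mul_le_mul_of_nonneg_left (hC.abs_log_sub_log_le ht y) (abs_nonneg _))
    simp at h1
    linarith

lemma integral_mul_smoothing_eq_integral_prod {t : ℝ} (ht : 0 < t) {g : E → ℝ}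
    (hg : Continuous g) {B : ℝ} (hB : ∀ y, |g y| ≤ B) :
    ∫ y, g y * smoothing P (heatKernel t) y =
      ∫ w : E × E, g (w.1 + √(2 * t) • w.2) ∂P.prod (stdGaussian E) := by
  rw [(heatBounded_heatKernel ht).integral_mul_smoothing P hg hB, integral_prod]
  · refine integral_congr_ae (ae_of_all _ fun u => ?_)
    exact integral_mul_heatKernel ht (f := fun x => g (u + x))
      (Continuous.measurable (by fun_prop))
  · exact .of_bound (Continuous.aestronglyMeasurable (by fun_prop)) B (ae_of_all _ fun w => hB _)

lemma tendsto_integral_mul_smoothing {g : E → ℝ} (hg : Continuous g) {B : ℝ}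
    (hB : ∀ y, |g y| ≤ B) :
    Tendsto (fun t => ∫ y, g y * smoothing P (heatKernel t) y) (𝓝[>] 0) (𝓝 (∫ u, g u ∂P)) := by
  have key : Tendsto (fun t : ℝ => ∫ w : E × E, g (w.1 + √(2 * t) • w.2) ∂P.prod (stdGaussian E))
      (𝓝[>] 0) (𝓝 (∫ w : E × E, g w.1 ∂P.prod (stdGaussian E))) := by
    refine tendsto_integral_filter_of_dominated_convergence (fun _ => B)
      (.of_forall fun t => Continuous.aestronglyMeasurable (by fun_prop))
      (.of_forall fun t => ae_of_all _ fun w => hB _) (integrable_const B)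
      (ae_of_all _ fun w => ?_)
    -- At `t = 0` the square root vanishes, so continuity there gives the limit `g w.1`.
    have : Continuous fun t : ℝ => g (w.1 + √(2 * t) • w.2) := by fun_prop
    simpa using (this.continuousWithinAt (s := Set.Ioi 0) (x := 0)).tendsto
  have e : ∫ w : E × E, g w.1 ∂P.prod (stdGaussian E) = ∫ u, g u ∂P := by
    simp [integral_fun_fst]
  rw [e] at key
  refine key.congr' ?_
  filter_upwards [self_mem_nhdsWithin] with t ht
  exact (integral_mul_smoothing_eq_integral_prod P ht hg hB).symm

lemma exists_abs_exp_sub_one_le {α : Type*} {g : α → ℝ} {B : ℝ} (hB : ∀ y, |g y| ≤ B) (y : α) :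
    |exp (g y) - 1| ≤ exp B + 1 := by
  refine (abs_sub _ _).trans ?_
  rw [abs_one, abs_of_pos (exp_pos _)]
  gcongr
  exact (le_abs_self _).trans (hB y)

variable {P Q}

/-- Adding common independent noise cannot increase the dual functional: for each fixed noise value
the translate of `g` is a test function for `(P, Q)`, and the bound is averaged over the noise. -/
lemma klDual_smoothing_le {M : ℝ} (hM : 0 ≤ M) (h : klDiv P Q ≤ ENNReal.ofReal M) {t : ℝ}
    (ht : 0 < t) {g : E → ℝ} (hg : Continuous g) {B : ℝ} (hB : ∀ y, |g y| ≤ B) :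
    (∫ y, g y * smoothing P (heatKernel t) y) -
      ∫ y, (exp (g y) - 1) * smoothing Q (heatKernel t) y ≤ M := by
  have i1 : Integrable (fun w : E × E => g (w.1 + √(2 * t) • w.2)) (P.prod (stdGaussian E)) :=
    .of_bound (Continuous.aestronglyMeasurable (by fun_prop)) B (ae_of_all _ fun w => hB _)
  have i2 : Integrable (fun w : E × E => exp (g (w.1 + √(2 * t) • w.2)) - 1)
      (Q.prod (stdGaussian E)) :=
    .of_bound (Continuous.aestronglyMeasurable (by fun_prop)) _
      (ae_of_all _ fun w => exists_abs_exp_sub_one_le hB _)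
  rw [integral_mul_smoothing_eq_integral_prod P ht hg hB,
    integral_mul_smoothing_eq_integral_prod Q ht (g := fun y => exp (g y) - 1) (by fun_prop)
      (exists_abs_exp_sub_one_le hB), integral_prod_symm _ i1, integral_prod_symm _ i2,
    ← integral_sub i1.integral_prod_right i2.integral_prod_right]
  calc _ ≤ ∫ z, M ∂stdGaussian E := by
        refine integral_mono (i1.integral_prod_right.sub i2.integral_prod_right)
          (integrable_const M) fun z => ?_
        have := (klDual_le_klDiv (P := P) (Q := Q) (g := fun u => g (u + √(2 * t) • z))
          (Continuous.measurable (by fun_prop)) fun u => hB _).trans h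
        exact (ENNReal.ofReal_le_ofReal_iff hM).1 this
    _ = M := by simp

/-- The optimal test function `log p - log q` is admissible since comparability bounds it; its
exponential term integrates `p - q`, which gives zero. -/
theorem Comparable.smoothedEntropy_le {C : ℝ≥0} (hC : Comparable P Q C) {M : ℝ} (hM : 0 ≤ M)
    (h : klDiv P Q ≤ ENNReal.ofReal M) {t : ℝ} (ht : 0 < t) : smoothedEntropy P Q t ≤ M := by
  have hb := heatBounded_heatKernel (E := E) ht
  refine le_of_eq_of_le ?_ (klDual_smoothing_le hM h ht (hC.continuous_log_sub_log ht)
    (hC.abs_log_sub_log_le ht))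
  have e : ∀ y, (exp (log (smoothing P (heatKernel t) y) - log (smoothing Q (heatKernel t) y)) - 1)
      * smoothing Q (heatKernel t) y =
      smoothing P (heatKernel t) y - smoothing Q (heatKernel t) y := by
    intro y
    have hp := smoothing_heatKernel_pos P ht y
    have hq := smoothing_heatKernel_pos Q ht y
    rw [exp_sub, exp_log hp, exp_log hq]
    field_simp
  simp_rw [e]
  rw [integral_sub (hb.integrable_smoothing P) (hb.integrable_smoothing Q),
    integral_smoothing_heatKernel P ht, integral_smoothing_heatKernel Q ht]
  simp only [smoothedEntropy, mul_comm, sub_self, sub_zero]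

/-- Lower semicontinuity under weak convergence as `t → 0`, tested on bounded continuous functions.
-/
theorem Comparable.klDiv_le {C : ℝ≥0} (hC : Comparable P Q C) {M : ℝ}
    (h : ∀ t, 0 < t → smoothedEntropy P Q t ≤ M) : klDiv P Q ≤ ENNReal.ofReal M := by
  refine klDiv_le_of_klDual fun g hg ⟨B, hB⟩ => ?_
  have hB' := exists_abs_exp_sub_one_le hB
  have lim := (tendsto_integral_mul_smoothing P hg hB).sub
    (tendsto_integral_mul_smoothing Q (g := fun y => exp (g y) - 1) (by fun_prop) hB')
  refine le_of_tendsto lim ?_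
  filter_upwards [self_mem_nhdsWithin] with t ht
  refine le_trans ?_ (h t ht)
  have ht : 0 < t := ht
  have hb := heatBounded_heatKernel (E := E) ht
  have i1 := hb.integrable_mul_smoothing P hg hB
  have i2 := hb.integrable_mul_smoothing Q (g := fun y => exp (g y) - 1) (by fun_prop) hB'
  have i3 : Integrable fun y => smoothing Q (heatKernel t) y - smoothing P (heatKernel t) y :=
    (hb.integrable_smoothing Q).sub (hb.integrable_smoothing P)
  have h0 : ∫ y, (smoothing Q (heatKernel t) y - smoothing P (heatKernel t) y) = 0 := by
    rw [integral_sub (hb.integrable_smoothing Q) (hb.integrable_smoothing P),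
      integral_smoothing_heatKernel P ht, integral_smoothing_heatKernel Q ht, sub_self]
  rw [← integral_sub i1 i2, smoothedEntropy, ← add_zero (∫ y, _ * (_ - _)), ← h0,
    ← integral_add (hC.integrable_smoothedEntropy ht) i3]
  exact integral_mono (i1.sub i2) ((hC.integrable_smoothedEntropy ht).add i3) fun y =>
    mul_log_sub_log_ge (smoothing_heatKernel_pos P ht y) (smoothing_heatKernel_pos Q ht y) _

end EntropyLimits

/-! ### Scores as posterior means, and the identity for comparable measures. -/

section Denoising

open Real Filter Topology
open scoped NNReal

variable {E : Type*} [NormedAddCommGroup E] [InnerProductSpace ℝ E] [MeasurableSpace E]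

/-- The posterior mean of a signal with law `P` observed as `y` under Gaussian noise with
covariance `2t`. -/
noncomputable def postMean (P : Measure E) (t : ℝ) (y : E) : E :=
  (smoothing P (heatKernel t) y)⁻¹ • ∫ u, heatKernel t (y - u) • u ∂P

/-- The squared distance of the posterior means for two priors, weighted by the density of the
observation under the first one. -/
noncomputable def denoisingGapDensity (P Q : Measure E) (t : ℝ) (y : E) : ℝ :=
  smoothing P (heatKernel t) y * ‖postMean P t y - postMean Q t y‖ ^ 2

variable [BorelSpace E] [FiniteDimensional ℝ E]

/-- The mean squared distance of the posterior means for two priors, integrated over the noise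
levels. -/
noncomputable def denoisingDiv (P Q : Measure E) : ℝ≥0∞ :=
  ∫⁻ t in Set.Ioi (0 : ℝ), ENNReal.ofReal (1 / (4 * t ^ 2)) *
    ∫⁻ y, ENNReal.ofReal (denoisingGapDensity P Q t y)

section Measurability

variable {β : Type*} [MeasurableSpace β] (κ : Kernel β E) [IsMarkovKernel κ]

lemma measurable_smoothing_heatKernel_kernel :
    Measurable fun w : β × ℝ × E => smoothing (κ w.1) (heatKernel w.2.1) w.2.2 := by
  have h : StronglyMeasurable fun w : (β × ℝ × E) × E => heatKernel w.1.2.1 (w.1.2.2 - w.2) := by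
    refine Measurable.stronglyMeasurable ?_
    exact measurable_heatKernel_uncurry.comp
      (f := fun w : (β × ℝ × E) × E => (w.1.2.1, w.1.2.2 - w.2)) (by fun_prop)
  exact (h.integral_kernel_prod_right' (κ := κ.comap Prod.fst measurable_fst)).measurable

lemma measurable_postMean_kernel :
    Measurable fun w : β × ℝ × E => postMean (κ w.1) w.2.1 w.2.2 := by
  have h : StronglyMeasurable fun w : (β × ℝ × E) × E =>
      heatKernel w.1.2.1 (w.1.2.2 - w.2) • w.2 := by
    refine Measurable.stronglyMeasurable ?_
    refine Measurable.smul ?_ measurable_snd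
    exact measurable_heatKernel_uncurry.comp
      (f := fun w : (β × ℝ × E) × E => (w.1.2.1, w.1.2.2 - w.2)) (by fun_prop)
  exact (measurable_smoothing_heatKernel_kernel κ).inv.smul
    (h.integral_kernel_prod_right' (κ := κ.comap Prod.fst measurable_fst)).measurable

lemma measurable_denoisingGapDensity_kernel (η : Kernel β E) [IsMarkovKernel η] :
    Measurable fun w : β × ℝ × E => denoisingGapDensity (κ w.1) (η w.1) w.2.1 w.2.2 :=
  (measurable_smoothing_heatKernel_kernel κ).mul
    (((measurable_postMean_kernel κ).sub (measurable_postMean_kernel η)).norm.pow_const 2)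

lemma measurable_lintegral_denoisingGapDensity_kernel (η : Kernel β E) [IsMarkovKernel η] :
    Measurable fun w : β × ℝ => ∫⁻ y, ENNReal.ofReal (denoisingGapDensity (κ w.1) (η w.1) w.2 y) :=
  Measurable.lintegral_prod_right' (ν := volume)
    (f := fun w : (β × ℝ) × E => ENNReal.ofReal (denoisingGapDensity (κ w.1.1) (η w.1.1) w.1.2 w.2))
    (((measurable_denoisingGapDensity_kernel κ η).comp
      (f := fun w : (β × ℝ) × E => (w.1.1, w.1.2, w.2)) (by fun_prop)).ennreal_ofReal)

end Measurability

variable (P Q : Measure E) [IsProbabilityMeasure P] [IsProbabilityMeasure Q]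

lemma measurable_denoisingGapDensity :
    Measurable fun w : ℝ × E => denoisingGapDensity P Q w.1 w.2 :=
  (measurable_denoisingGapDensity_kernel (Kernel.const Unit P) (Kernel.const Unit Q)).comp
    (f := fun w : ℝ × E => ((), w)) (by fun_prop)

lemma measurable_lintegral_denoisingGapDensity :
    Measurable fun t : ℝ => ∫⁻ y, ENNReal.ofReal (denoisingGapDensity P Q t y) :=
  (measurable_lintegral_denoisingGapDensity_kernel (Kernel.const Unit P)
    (Kernel.const Unit Q)).comp (f := fun t : ℝ => ((), t)) (by fun_prop)

lemma integrable_heatKernel_smul {t : ℝ} (ht : 0 < t) (y : E) :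
    Integrable (fun u => heatKernel t (y - u) • u) P := by
  obtain ⟨C, hC, hb⟩ := exists_mul_heatKernel_le (E := E) ht
  have hc := continuous_heatKernel (E := E) t
  have ht4 : 0 < 4 * t := by positivity
  have h1 : Integrable (fun u => heatKernel t (y - u) • (y - u)) P := by
    refine .of_bound (Continuous.aestronglyMeasurable (by fun_prop))
      (C * (4 * π * (4 * t)) ^ (-(Module.finrank ℝ E : ℝ) / 2)) (ae_of_all _ fun u => ?_)
    rw [norm_smul, norm_of_nonneg (heatKernel_pos ht _).le, mul_comm]
    calc ‖y - u‖ * heatKernel t (y - u) ≤ (1 + ‖y - u‖ ^ 2) * heatKernel t (y - u) := by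
          refine mul_le_mul_of_nonneg_right ?_ (heatKernel_pos ht _).le
          nlinarith [sq_nonneg (‖y - u‖ - 1), norm_nonneg (y - u)]
      _ ≤ C * heatKernel (4 * t) (y - u) := hb t ⟨by linarith, by linarith⟩ _
      _ ≤ _ := by gcongr; exact heatKernel_le ht4 _
  have h2 := ((heatBounded_heatKernel ht).integrable_sub (P := P) y).smul_const y
  refine (h2.sub h1).congr (ae_of_all _ fun u => ?_)
  simp [← smul_sub]

/-- Tweedie's formula. -/
lemma score_eq_inner_postMean (v : E) {t : ℝ} (ht : 0 < t) (y : E) :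
    score P v t y = inner ℝ (postMean P t y - y) v / (2 * t) := by
  have hp := smoothing_heatKernel_pos P ht y
  have hi := integrable_heatKernel_smul P ht y
  have h1 : smoothing P (heatKernelDeriv v t) y =
      (inner ℝ (∫ u, heatKernel t (y - u) • u ∂P) v - smoothing P (heatKernel t) y * inner ℝ y v) /
        (2 * t) := by
    rw [real_inner_comm, ← integral_inner hi, smoothing, smoothing, ← integral_mul_const,
      ← integral_sub (hi.const_inner v)
        (((heatBounded_heatKernel ht).integrable_sub y).mul_const _), ← integral_div]
    refine integral_congr_ae (ae_of_all _ fun u => ?_)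
    simp only [heatKernelDeriv, inner_sub_left, real_inner_smul_right, real_inner_comm]
    ring
  rw [score, h1, postMean, inner_sub_left, real_inner_smul_left]
  field_simp

lemma sum_score_sub_sq {t : ℝ} (ht : 0 < t) (y : E) :
    ∑ i, (score P (stdOrthonormalBasis ℝ E i) t y - score Q (stdOrthonormalBasis ℝ E i) t y) ^ 2 =
      1 / (4 * t ^ 2) * ‖postMean P t y - postMean Q t y‖ ^ 2 := by
  rw [← (stdOrthonormalBasis ℝ E).sum_sq_inner_left, Finset.mul_sum]
  refine Finset.sum_congr rfl fun i _ => ?_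
  rw [score_eq_inner_postMean P _ ht, score_eq_inner_postMean Q _ ht, ← sub_div, ← inner_sub_left,
    sub_sub_sub_cancel_right]
  field_simp
  ring

lemma smoothedFisher_nonneg {t : ℝ} (ht : 0 < t) : 0 ≤ smoothedFisher P Q t :=
  integral_nonneg fun y => mul_nonneg (smoothing_heatKernel_pos P ht y).le
    (Finset.sum_nonneg fun _ _ => sq_nonneg _)

variable {P Q} {C : ℝ≥0} (hC : Comparable P Q C)
include hC

lemma Comparable.ofReal_smoothedFisher {t : ℝ} (ht : 0 < t) :
    ENNReal.ofReal (smoothedFisher P Q t) = ENNReal.ofReal (1 / (4 * t ^ 2)) *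
      ∫⁻ y, ENNReal.ofReal (denoisingGapDensity P Q t y) := by
  have hi : Integrable fun y => smoothing P (heatKernel t) y *
      ∑ i, (score P (stdOrthonormalBasis ℝ E i) t y -
        score Q (stdOrthonormalBasis ℝ E i) t y) ^ 2 := by
    simp_rw [Finset.mul_sum]
    exact integrable_finsetSum _ fun i _ => hC.integrable_mul_score_sub_sq _ ht
  rw [smoothedFisher, ofReal_integral_eq_lintegral_ofReal hi (ae_of_all _ fun y =>
    mul_nonneg (smoothing_heatKernel_pos P ht y).le (Finset.sum_nonneg fun i _ => sq_nonneg _)),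
    ← lintegral_const_mul' _ _ (by simp)]
  refine lintegral_congr fun y => ?_
  rw [← ENNReal.ofReal_mul (by positivity), sum_score_sub_sq P Q ht, denoisingGapDensity,
    mul_left_comm]

/-- De Bruijn's identity integrated over `(s, ∞)`. The sign of the derivative and the limit at
infinity supply its integrability. -/
lemma Comparable.ofReal_smoothedEntropy {s : ℝ} (hs : 0 < s) :
    ENNReal.ofReal (smoothedEntropy P Q s) =
      ∫⁻ t in Set.Ioi s, ENNReal.ofReal (1 / (4 * t ^ 2)) *
        ∫⁻ y, ENNReal.ofReal (denoisingGapDensity P Q t y) := by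
  have hd : ∀ t ∈ Set.Ici s, HasDerivAt (smoothedEntropy P Q) (-smoothedFisher P Q t) t :=
    fun t ht => hC.hasDerivAt_smoothedEntropy (hs.trans_le ht)
  have hnp : ∀ t ∈ Set.Ioi s, -smoothedFisher P Q t ≤ 0 := fun t ht => by
    have := smoothedFisher_nonneg P Q (hs.trans ht); linarith
  have hi := (integrableOn_Ioi_deriv_of_nonpos' hd hnp hC.tendsto_smoothedEntropy_atTop).neg
  have h := integral_Ioi_of_hasDerivAt_of_nonpos' hd hnp hC.tendsto_smoothedEntropy_atTop
  rw [integral_neg, zero_sub, neg_inj] at h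
  simp only [Pi.neg_def, neg_neg] at hi
  rw [← h, ofReal_integral_eq_lintegral_ofReal hi]
  · exact setLIntegral_congr_fun measurableSet_Ioi fun t ht =>
      hC.ofReal_smoothedFisher (hs.trans ht)
  · exact (ae_restrict_mem measurableSet_Ioi).mono fun t ht =>
      smoothedFisher_nonneg P Q (hs.trans ht)

/-- Each tail integral over `(s, ∞)` is a smoothed entropy. Bounding all of them by the full
integral gives `≤`; bounding them by `klDiv P Q` and exhausting `(0, ∞)` gives `≥`. -/
theorem Comparable.klDiv_eq_denoisingDiv : klDiv P Q = denoisingDiv P Q := by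
  apply le_antisymm
  · by_cases htop : denoisingDiv P Q = ∞
    · simp [htop]
    rw [← ENNReal.ofReal_toReal htop]
    refine hC.klDiv_le fun s hs => ?_
    rw [← ENNReal.ofReal_le_iff_le_toReal htop, hC.ofReal_smoothedEntropy hs]
    exact lintegral_mono_set (Set.Ioi_subset_Ioi hs.le)
  · by_cases htop : klDiv P Q = ∞
    · simp [htop]
    have hU : Set.Ioi (0 : ℝ) = ⋃ n : ℕ, Set.Ioi ((n : ℝ) + 1)⁻¹ := by
      ext t
      simp only [Set.mem_Ioi, Set.mem_iUnion]
      refine ⟨fun ht => ?_, fun ⟨n, hn⟩ => lt_trans (by positivity) hn⟩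
      obtain ⟨n, hn⟩ := exists_nat_one_div_lt ht
      exact ⟨n, by simpa using hn⟩
    have hmono : Monotone fun n : ℕ => Set.Ioi ((n : ℝ) + 1)⁻¹ := fun m n hmn =>
      Set.Ioi_subset_Ioi (by gcongr)
    rw [denoisingDiv, hU, setLIntegral_iUnion_of_directed _ hmono.directed_le]
    refine iSup_le fun n => ?_
    rw [← hC.ofReal_smoothedEntropy (by positivity), ENNReal.ofReal_le_iff_le_toReal htop]
    exact hC.smoothedEntropy_le ENNReal.toReal_nonneg (ENNReal.ofReal_toReal htop).ge
      (by positivity)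

end Denoising

/-! ### Removing comparability by mixing the two measures. -/

section Mixture

open Real Filter Topology
open scoped NNReal

lemma nnreal_smul_measure_apply {α : Type*} [MeasurableSpace α] (b : ℝ≥0) (P : Measure α)
    (s : Set α) : (b • P) s = (b : ℝ≥0∞) * P s := rfl

lemma tendsto_coe_of_add_eq_one {a b : ℕ → ℝ≥0} (hab : ∀ k, a k + b k = 1)
    (hb : Tendsto b atTop (𝓝 0)) :
    Tendsto (fun k => (b k : ℝ)) atTop (𝓝 0) ∧ Tendsto (fun k => (a k : ℝ)) atTop (𝓝 1) := by
  have hbR : Tendsto (fun k => (b k : ℝ)) atTop (𝓝 0) := NNReal.tendsto_coe.2 hb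
  have : ∀ k, (a k : ℝ) = 1 - b k := fun k => by
    rw [eq_sub_iff_add_eq]; exact_mod_cast hab k
  refine ⟨hbR, ?_⟩
  simp_rw [this]
  simpa using hbR.const_sub 1

lemma isProbabilityMeasure_mix {α : Type*} [MeasurableSpace α] (P Q : Measure α)
    [IsProbabilityMeasure P] [IsProbabilityMeasure Q] {a b : ℝ≥0} (hab : a + b = 1) :
    IsProbabilityMeasure (a • P + b • Q) := by
  constructor
  rw [Measure.add_apply, nnreal_smul_measure_apply, nnreal_smul_measure_apply, measure_univ,
    measure_univ, mul_one, mul_one, ← ENNReal.coe_add, hab, ENNReal.coe_one]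

lemma integral_mix {α F : Type*} [MeasurableSpace α] [NormedAddCommGroup F] [NormedSpace ℝ F]
    {P Q : Measure α} {f : α → F} (hP : Integrable f P) (hQ : Integrable f Q) (a b : ℝ≥0) :
    ∫ x, f x ∂(a • P + b • Q) = (a : ℝ) • ∫ x, f x ∂P + (b : ℝ) • ∫ x, f x ∂Q := by
  rw [integral_add_measure hP.smul_measure_nnreal hQ.smul_measure_nnreal,
    integral_smul_nnreal_measure, integral_smul_nnreal_measure]
  rfl

lemma le_smul_of_smul_le {α : Type*} [MeasurableSpace α] {P Q : Measure α} {b C : ℝ≥0}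
    (hb : b ≠ 0) (hC : b⁻¹ ≤ C) (h : b • P ≤ Q) : P ≤ C • Q := by
  refine Measure.le_iff.2 fun s _ => ?_
  have h1 := Measure.le_iff'.1 h s
  rw [nnreal_smul_measure_apply] at h1 ⊢
  calc P s = (b⁻¹ : ℝ≥0) * (b * P s) := by
        rw [← mul_assoc, ← ENNReal.coe_mul, inv_mul_cancel₀ hb]; simp
    _ ≤ C * Q s := by gcongr

/-- `P' ≥ bQ` bounds `Q`, hence `Q'`, by a multiple of `P'`, while `Q' ≥ bP'` bounds `P'`. Mixing
only `P` and `Q` keeps the entropy and the denoising gap below their original values. -/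
lemma comparable_mix {E : Type*} [NormedAddCommGroup E] [InnerProductSpace ℝ E]
    [MeasurableSpace E] (P Q : Measure E) {a b : ℝ≥0} (hb : b ≠ 0) :
    ∃ C, Comparable (a • P + b • Q) (a • Q + b • (a • P + b • Q)) C := by
  set P' := a • P + b • Q with hP'
  have h1 : b • P' ≤ a • Q + b • P' := Measure.le_add_left le_rfl
  have h2 : b • Q ≤ P' := Measure.le_add_left le_rfl
  refine ⟨b⁻¹ + (a * b⁻¹ + b), le_smul_of_smul_le hb le_self_add h1, ?_⟩
  have h3 : Q ≤ b⁻¹ • P' := le_smul_of_smul_le hb le_rfl h2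
  refine Measure.le_iff.2 fun s _ => ?_
  have h4 := Measure.le_iff'.1 h3 s
  rw [nnreal_smul_measure_apply] at h4
  rw [Measure.add_apply, nnreal_smul_measure_apply, nnreal_smul_measure_apply,
    nnreal_smul_measure_apply]
  calc (a : ℝ≥0∞) * Q s + b * P' s ≤ a * ((b⁻¹ : ℝ≥0) * P' s) + b * P' s := by gcongr
    _ = ((a * b⁻¹ + b : ℝ≥0) : ℝ≥0∞) * P' s := by push_cast; ring
    _ ≤ _ := mul_le_mul' (ENNReal.coe_le_coe.2 le_add_self) le_rfl

lemma klDual_self_nonpos {α : Type*} [MeasurableSpace α] (P : Measure α) [IsProbabilityMeasure P]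
    {g : α → ℝ} (hg : Measurable g) {B : ℝ} (hB : ∀ x, |g x| ≤ B) : klDual P P g ≤ 0 := by
  have := klDual_le_klDiv (P := P) (Q := P) hg hB
  rwa [klDiv_self, nonpos_iff_eq_zero, ENNReal.ofReal_eq_zero] at this

lemma klDual_mix {α : Type*} [MeasurableSpace α] (P Q : Measure α)
    [IsProbabilityMeasure P] [IsProbabilityMeasure Q] {a b : ℝ≥0}
    {g : α → ℝ} (hg : Measurable g) {B : ℝ} (hB : ∀ x, |g x| ≤ B) :
    klDual (a • P + b • Q) (a • Q + b • (a • P + b • Q)) g =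
      a * ∫ x, g x ∂P + b * ∫ x, g x ∂Q - (a * ∫ x, (exp (g x) - 1) ∂Q +
        b * (a * ∫ x, (exp (g x) - 1) ∂P + b * ∫ x, (exp (g x) - 1) ∂Q)) := by
  have e := fun (R : Measure α) (_ : IsFiniteMeasure R) => integrable_exp_sub_one hg hB R
  have i := fun (R : Measure α) (_ : IsFiniteMeasure R) => integrable_of_abs_le hg hB R
  rw [klDual, integral_mix (i P inferInstance) (i Q inferInstance),
    integral_mix (e Q inferInstance) (e _ inferInstance),
    integral_mix (e P inferInstance) (e Q inferInstance)]
  simp only [smul_eq_mul]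

variable {E : Type*} [NormedAddCommGroup E] [InnerProductSpace ℝ E] [MeasurableSpace E]
  [BorelSpace E] [FiniteDimensional ℝ E] (P Q : Measure E) [IsProbabilityMeasure P]
  [IsProbabilityMeasure Q]

/-- The dual functional at `(P', Q')` equals `a²` times its value at `(P, Q)`, plus `ab` times that
at `(P, P)`, plus `b` times that at `(Q, Q)`; the last two are nonpositive. -/
lemma klDiv_mix_le {a b : ℝ≥0} (hab : a + b = 1) :
    klDiv (a • P + b • Q) (a • Q + b • (a • P + b • Q)) ≤ klDiv P Q := by
  by_cases htop : klDiv P Q = ∞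
  · simp [htop]
  have := isProbabilityMeasure_mix P Q hab
  have := isProbabilityMeasure_mix Q (a • P + b • Q) hab
  rw [← ENNReal.ofReal_toReal htop]
  set M := (klDiv P Q).toReal with hM
  have hM0 : 0 ≤ M := ENNReal.toReal_nonneg
  refine klDiv_le_of_klDual_measurable fun g hg ⟨B, hB⟩ => ?_
  have h1 : klDual P Q g ≤ M :=
    (ENNReal.ofReal_le_iff_le_toReal htop).1 (klDual_le_klDiv hg hB)
  have h2 := klDual_self_nonpos P hg hB
  have h3 := klDual_self_nonpos Q hg hB
  rw [klDual_mix P Q hg hB]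
  unfold klDual at h1 h2 h3
  set x := ∫ x, g x ∂P
  set y := ∫ x, g x ∂Q
  set z := ∫ x, (exp (g x) - 1) ∂P
  set w := ∫ x, (exp (g x) - 1) ∂Q
  have ha : (a : ℝ) = 1 - b := by
    rw [eq_sub_iff_add_eq]; exact_mod_cast hab
  have ha0 : (0 : ℝ) ≤ a := a.2
  have hb0 : (0 : ℝ) ≤ b := b.2
  have e : a * x + b * y - (a * w + b * (a * z + b * w)) =
      a * a * (x - w) + a * b * (x - z) + b * (y - w) := by rw [ha]; ring
  rw [e]
  have h4 : (a : ℝ) * a * (x - w) ≤ M := by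
    have : (a : ℝ) * a ≤ 1 := by nlinarith
    calc (a : ℝ) * a * (x - w) ≤ a * a * M := by gcongr
      _ ≤ M := mul_le_of_le_one_left hM0 this
  have h5 := mul_nonpos_of_nonneg_of_nonpos (mul_nonneg ha0 hb0) h2
  have h6 := mul_nonpos_of_nonneg_of_nonpos hb0 h3
  linarith

variable {P Q} in
lemma smoothing_mix {ψ : E → ℝ} (hψ : HeatBounded ψ) (a b : ℝ≥0) (y : E) :
    smoothing (a • P + b • Q) ψ y = a * smoothing P ψ y + b * smoothing Q ψ y :=
  integral_mix (hψ.integrable_sub y) (hψ.integrable_sub y) a b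

lemma smoothing_smul_postMean {t : ℝ} (ht : 0 < t) (y : E) :
    smoothing P (heatKernel t) y • postMean P t y = ∫ u, heatKernel t (y - u) • u ∂P := by
  rw [postMean, smul_inv_smul₀ (smoothing_heatKernel_pos P ht y).ne']

lemma smoothing_smul_postMean_mix {a b : ℝ≥0} (hab : a + b = 1) {t : ℝ} (ht : 0 < t) (y : E) :
    smoothing (a • P + b • Q) (heatKernel t) y • postMean (a • P + b • Q) t y =
      (a : ℝ) • smoothing P (heatKernel t) y • postMean P t y +
        (b : ℝ) • smoothing Q (heatKernel t) y • postMean Q t y := by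
  have := isProbabilityMeasure_mix P Q hab
  rw [smoothing_smul_postMean _ ht, smoothing_smul_postMean _ ht, smoothing_smul_postMean _ ht,
    integral_mix (integrable_heatKernel_smul P ht y) (integrable_heatKernel_smul Q ht y)]

/-- The posterior mean of a mixture is the convex combination of the posterior means, weighted by
the posterior probabilities of the two components. -/
lemma postMean_mix_sub {a b : ℝ≥0} (hab : a + b = 1) {t : ℝ} (ht : 0 < t) (y : E) :
    postMean (a • P + b • Q) t y - postMean Q t y =
      (a * smoothing P (heatKernel t) y / smoothing (a • P + b • Q) (heatKernel t) y) •
        (postMean P t y - postMean Q t y) := by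
  have := isProbabilityMeasure_mix P Q hab
  have hp := smoothing_heatKernel_pos (a • P + b • Q) ht y
  have h := smoothing_smul_postMean_mix P Q hab ht y
  have h2 := smoothing_mix (P := P) (Q := Q) (heatBounded_heatKernel ht) a b y
  rw [← smul_right_inj hp.ne', smul_sub, h, smul_smul _ (_ / _), mul_div_cancel₀ _ hp.ne', h2]
  module

lemma denoisingGapDensity_mix {a b : ℝ≥0} (hab : a + b = 1) {t : ℝ} (ht : 0 < t) (y : E) :
    denoisingGapDensity (a • P + b • Q) (a • Q + b • (a • P + b • Q)) t y =
      (a * smoothing P (heatKernel t) y + b * smoothing Q (heatKernel t) y)⁻¹ *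
      (a ^ 2 * smoothing P (heatKernel t) y * smoothing Q (heatKernel t) y /
        (a * smoothing Q (heatKernel t) y +
          b * (a * smoothing P (heatKernel t) y + b * smoothing Q (heatKernel t) y))) ^ 2 *
      ‖postMean P t y - postMean Q t y‖ ^ 2 := by
  have := isProbabilityMeasure_mix P Q hab
  have := isProbabilityMeasure_mix Q (a • P + b • Q) hab
  have hφ := heatBounded_heatKernel (E := E) ht
  have hp := smoothing_heatKernel_pos (a • P + b • Q) ht y
  -- The mixing lemma is used twice: once for `P'` against `Q`, once for `Q'`, a mixture of `Q` and
  -- `P'`, against `P'`.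
  have h1 := postMean_mix_sub P Q hab ht y
  have h2 := postMean_mix_sub Q (a • P + b • Q) hab ht y
  rw [denoisingGapDensity, ← norm_neg, neg_sub, h2, ← neg_sub (postMean _ _ _), h1, norm_smul,
    norm_neg, norm_smul, mul_pow, mul_pow, norm_eq_abs, norm_eq_abs, sq_abs, sq_abs,
    smoothing_mix hφ, smoothing_mix hφ, smoothing_mix hφ]
  rw [smoothing_mix hφ] at hp
  field_simp

lemma denoisingGapDensity_mix_le {a b : ℝ≥0} (hab : a + b = 1) {t : ℝ} (ht : 0 < t) (y : E) :
    denoisingGapDensity (a • P + b • Q) (a • Q + b • (a • P + b • Q)) t y ≤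
      denoisingGapDensity P Q t y := by
  rw [denoisingGapDensity_mix P Q hab ht, denoisingGapDensity]
  refine mul_le_mul_of_nonneg_right ?_ (sq_nonneg _)
  have hp := smoothing_heatKernel_pos P ht y
  have hq := smoothing_heatKernel_pos Q ht y
  set p := smoothing P (heatKernel t) y
  set q := smoothing Q (heatKernel t) y
  have ha1 : (a : ℝ) ≤ 1 := by exact_mod_cast le_of_le_of_eq le_self_add hab
  have hb0 : (0 : ℝ) ≤ b := b.2
  rcases (show (0 : ℝ) ≤ a from a.2).eq_or_lt with h0 | ha0
  · rw [← h0]; simp [hp.le]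
  have h1 : a * p ≤ a * p + b * q := by nlinarith [mul_nonneg hb0 hq.le]
  have h2 : a * q ≤ a * q + b * (a * p + b * q) := by
    have : 0 ≤ b * (a * p + b * q) := by positivity
    linarith
  -- Dropping the `b` terms from both denominators leaves exactly `a * p`.
  calc (a * p + b * q)⁻¹ * (a ^ 2 * p * q / (a * q + b * (a * p + b * q))) ^ 2
      ≤ (a * p)⁻¹ * (a ^ 2 * p * q / (a * q)) ^ 2 := by gcongr
    _ = a * p := by field_simp
    _ ≤ p := mul_le_of_le_one_left hp.le ha1

lemma denoisingDiv_mix_le {a b : ℝ≥0} (hab : a + b = 1) :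
    denoisingDiv (a • P + b • Q) (a • Q + b • (a • P + b • Q)) ≤ denoisingDiv P Q := by
  refine setLIntegral_mono' measurableSet_Ioi fun t ht => ?_
  gcongr with y
  exact denoisingGapDensity_mix_le P Q hab ht y

/-- The gap densities converge pointwise by their explicit formula; Fatou's lemma is applied in `y`,
then in `t`. -/
lemma denoisingDiv_le_liminf_mix {a b : ℕ → ℝ≥0} (hab : ∀ k, a k + b k = 1)
    (hb : Tendsto b atTop (𝓝 0)) :
    denoisingDiv P Q ≤ liminf (fun k =>
      denoisingDiv (a k • P + b k • Q) (a k • Q + b k • (a k • P + b k • Q))) atTop := by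
  have hP := fun k => isProbabilityMeasure_mix P Q (hab k)
  have hQ := fun k => isProbabilityMeasure_mix Q (a k • P + b k • Q) (hab k)
  obtain ⟨hbR, haR⟩ := tendsto_coe_of_add_eq_one hab hb
  have hlim : ∀ t, 0 < t → ∀ y, Tendsto (fun k => denoisingGapDensity (a k • P + b k • Q)
      (a k • Q + b k • (a k • P + b k • Q)) t y) atTop (𝓝 (denoisingGapDensity P Q t y)) := by
    intro t ht y
    have hp := smoothing_heatKernel_pos P ht y
    have hq := smoothing_heatKernel_pos Q ht y
    simp_rw [denoisingGapDensity_mix P Q (hab _) ht, denoisingGapDensity]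
    set p := smoothing P (heatKernel t) y
    set q := smoothing Q (heatKernel t) y
    refine Tendsto.mul_const _ ?_
    have l1 : Tendsto (fun k => a k * p + b k * q) atTop (𝓝 p) := by
      simpa using (haR.mul_const p).add (hbR.mul_const q)
    have l2 : Tendsto (fun k => a k * q + b k * (a k * p + b k * q)) atTop (𝓝 q) := by
      simpa using (haR.mul_const q).add (hbR.mul l1)
    have l3 := (l1.inv₀ hp.ne').mul
      (((((haR.pow 2).mul_const p).mul_const q).div l2 hq.ne').pow 2)
    have e : p⁻¹ * (1 ^ 2 * p * q / q) ^ 2 = p := by field_simp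
    rw [e] at l3
    exact l3
  have hgap : ∀ t, 0 < t → ∫⁻ y, ENNReal.ofReal (denoisingGapDensity P Q t y) ≤
      liminf (fun k => ∫⁻ y, ENNReal.ofReal (denoisingGapDensity (a k • P + b k • Q)
        (a k • Q + b k • (a k • P + b k • Q)) t y)) atTop := by
    intro t ht
    refine le_of_eq_of_le (lintegral_congr fun y => ?_) (lintegral_liminf_le fun k =>
      ((measurable_denoisingGapDensity _ _).comp
        (f := fun y : E => (t, y)) (by fun_prop)).ennreal_ofReal)
    exact ((ENNReal.continuous_ofReal.tendsto _).comp (hlim t ht y)).liminf_eq.symm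
  unfold denoisingDiv
  refine le_trans (setLIntegral_mono' measurableSet_Ioi fun t ht => ?_)
    (lintegral_liminf_le fun k => Measurable.mul (by fun_prop)
      (measurable_lintegral_denoisingGapDensity _ _))
  calc _ ≤ liminf (fun _ : ℕ => ENNReal.ofReal (1 / (4 * t ^ 2))) atTop * _ := by
        rw [liminf_const]; exact mul_le_mul_right (hgap t ht) _
    _ ≤ _ := ENNReal.le_liminf_mul

/-- The relative entropy of two priors is the integral over all noise levels of the mean squared
distance of their posterior means. No moment assumption is needed. -/
theorem klDiv_eq_denoisingDiv : klDiv P Q = denoisingDiv P Q := by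
  set b : ℕ → ℝ≥0 := fun k => ((k : ℝ≥0) + 1)⁻¹ with hbdef
  set a : ℕ → ℝ≥0 := fun k => 1 - b k with hadef
  have hb0 : ∀ k, b k ≠ 0 := fun k => by positivity
  have hb1 : ∀ k, b k ≤ 1 := fun k => inv_le_one_of_one_le₀ (by simp)
  have hab : ∀ k, a k + b k = 1 := fun k => tsub_add_cancel_of_le (hb1 k)
  have hb : Tendsto b atTop (𝓝 0) := by
    simpa [hbdef] using tendsto_one_div_add_atTop_nhds_zero_nat (𝕜 := ℝ≥0)
  have hP := fun k => isProbabilityMeasure_mix P Q (hab k)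
  have hQ := fun k => isProbabilityMeasure_mix Q (a k • P + b k • Q) (hab k)
  have heq : ∀ k, klDiv (a k • P + b k • Q) (a k • Q + b k • (a k • P + b k • Q)) =
      denoisingDiv (a k • P + b k • Q) (a k • Q + b k • (a k • P + b k • Q)) := fun k => by
    obtain ⟨C, hC⟩ := comparable_mix P Q (a := a k) (hb0 k)
    exact hC.klDiv_eq_denoisingDiv
  apply le_antisymm
  · by_cases htop : denoisingDiv P Q = ∞
    · simp [htop]
    rw [← ENNReal.ofReal_toReal htop]
    -- For a fixed test function the dual functional of the mixtures is polynomial in the weights,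
    -- so it converges to its value at `(P, Q)`.
    refine klDiv_le_of_klDual_measurable fun g hg ⟨B, hB⟩ => ?_
    obtain ⟨hbR, haR⟩ := tendsto_coe_of_add_eq_one hab hb
    have lim : Tendsto (fun k => klDual (a k • P + b k • Q)
        (a k • Q + b k • (a k • P + b k • Q)) g) atTop (𝓝 (klDual P Q g)) := by
      simp_rw [klDual_mix P Q hg hB]
      have := ((haR.mul_const (∫ x, g x ∂P)).add (hbR.mul_const (∫ x, g x ∂Q))).sub
        ((haR.mul_const (∫ x, (exp (g x) - 1) ∂Q)).add
          (hbR.mul ((haR.mul_const (∫ x, (exp (g x) - 1) ∂P)).add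
            (hbR.mul_const (∫ x, (exp (g x) - 1) ∂Q)))))
      convert this using 2
      simp [klDual]
    refine le_of_tendsto lim (.of_forall fun k => ?_)
    rw [← ENNReal.ofReal_le_iff_le_toReal htop]
    refine (klDual_le_klDiv hg hB).trans ?_
    rw [heq]
    exact denoisingDiv_mix_le P Q (hab k)
  · refine (denoisingDiv_le_liminf_mix P Q hab hb).trans ?_
    simp_rw [← heq]
    refine (liminf_le_liminf (v := fun _ => klDiv P Q)
      (.of_forall fun k => klDiv_mix_le P Q (hab k))).trans ?_
    simp

end Mixture

/-! ### Mutual information as an average of relative entropies. -/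

section MutualInformation

open Filter

/-- The conditional relative entropy is the mean of the relative entropies. -/
lemma klDiv_compProd_eq_lintegral {α β : Type*} [MeasurableSpace α] [MeasurableSpace β]
    [MeasurableSpace.CountableOrCountablyGenerated α β] (ν : Measure α) [IsProbabilityMeasure ν]
    (κ η : Kernel α β) [IsMarkovKernel κ] [IsMarkovKernel η] :
    klDiv (ν ⊗ₘ κ) (ν ⊗ₘ η) = ∫⁻ a, klDiv (κ a) (η a) ∂ν := by
  by_cases hac : ∀ᵐ a ∂ν, κ a ≪ η a
  · have h1 : ν ⊗ₘ κ = (ν ⊗ₘ η).withDensity fun p => κ.rnDeriv η p.1 p.2 := by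
      rw [← Measure.compProd_withDensity (Kernel.measurable_rnDeriv κ η)]
      refine Measure.compProd_congr ?_
      filter_upwards [hac] with a ha
      exact (Kernel.withDensity_rnDeriv_eq ha).symm
    rw [klDiv_eq_lintegral_klFun_of_ac (Measure.absolutelyContinuous_compProd_right_iff.2 hac)]
    have h2 : (ν ⊗ₘ κ).rnDeriv (ν ⊗ₘ η) =ᵐ[ν ⊗ₘ η] fun p => κ.rnDeriv η p.1 p.2 := by
      rw [h1]
      exact Measure.rnDeriv_withDensity _ (Kernel.measurable_rnDeriv κ η)
    have hm : Measurable fun p : α × β => ENNReal.ofReal (klFun (κ.rnDeriv η p.1 p.2).toReal) :=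
      (measurable_klFun.comp (Kernel.measurable_rnDeriv κ η).ennreal_toReal).ennreal_ofReal
    rw [lintegral_congr_ae (g := fun p => ENNReal.ofReal (klFun (κ.rnDeriv η p.1 p.2).toReal))
      (by filter_upwards [h2] with p hp; rw [hp]), Measure.lintegral_compProd hm]
    refine lintegral_congr_ae ?_
    filter_upwards [hac] with a ha
    rw [klDiv_eq_lintegral_klFun_of_ac ha]
    refine lintegral_congr_ae ?_
    filter_upwards [Kernel.rnDeriv_eq_rnDeriv_measure (κ := κ) (η := η) (a := a)] with x hx
    rw [hx]
  · rw [klDiv_of_not_ac (by rwa [Measure.absolutelyContinuous_compProd_right_iff])]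
    -- Absolute continuity fails on a measurable set of positive `ν`-measure, where the integrand is
    -- infinite, so both sides are `∞`.
    symm
    set s := {a | κ a ≪ η a} with hs
    have hsm : MeasurableSet s := Kernel.measurableSet_absolutelyContinuous κ η
    have hpos : ν sᶜ ≠ 0 := hac
    refine top_le_iff.1 ?_
    calc ∞ = ∫⁻ _ in sᶜ, ∞ ∂ν := by rw [setLIntegral_const, ENNReal.top_mul hpos]
      _ = ∫⁻ a in sᶜ, klDiv (κ a) (η a) ∂ν :=
        setLIntegral_congr_fun hsm.compl fun a ha => (klDiv_of_not_ac ha).symm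
      _ ≤ ∫⁻ a, klDiv (κ a) (η a) ∂ν := setLIntegral_le_lintegral _ _

lemma klDiv_map_swap {α β : Type*} [MeasurableSpace α] [MeasurableSpace β]
    (μ ν : Measure (α × β)) [IsFiniteMeasure μ] [IsFiniteMeasure ν] :
    klDiv (μ.map Prod.swap) (ν.map Prod.swap) = klDiv μ ν := by
  refine le_antisymm (klDiv_map_le _ _ measurable_swap) ?_
  have h := klDiv_map_le (μ.map Prod.swap) (ν.map Prod.swap) (measurable_swap (α := β))
  simpa [Measure.map_map measurable_swap measurable_swap] using h

/-- With the coordinates swapped, the joint law is the composition of the law of `V` with `κ`, and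
the product law that with a constant kernel. -/
lemma mutualInformation_eq_lintegral_klDiv {Ω α β : Type*} [MeasurableSpace Ω] [MeasurableSpace α]
    [MeasurableSpace β] [MeasurableSpace.CountableOrCountablyGenerated β α] {μ : Measure Ω}
    [IsProbabilityMeasure μ] {U : Ω → α} {V : Ω → β} (hU : Measurable U) (hV : Measurable V)
    {κ : Kernel β α} [IsMarkovKernel κ] (hκ : μ.map (fun ω => (V ω, U ω)) = μ.map V ⊗ₘ κ) :
    mutualInformation μ U V = ∫⁻ v, klDiv (κ v) (μ.map U) ∂(μ.map V) := by
  have := Measure.isProbabilityMeasure_map (μ := μ) hU.aemeasurable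
  have := Measure.isProbabilityMeasure_map (μ := μ) hV.aemeasurable
  have := Measure.isProbabilityMeasure_map (μ := μ) (hU.prodMk hV).aemeasurable
  have h := klDiv_compProd_eq_lintegral (μ.map V) κ (Kernel.const β (μ.map U))
  simp only [Kernel.const_apply] at h
  rw [mutualInformation, ← klDiv_map_swap, ← h, ← hκ, Measure.compProd_const, Measure.prod_swap,
    Measure.map_map measurable_swap (hU.prodMk hV)]
  rfl

end MutualInformation

/-! ### Bayes' rule for a signal in Gaussian noise with side information. -/

section Posterior

open Real Filter Topology

variable {E : Type*} [NormedAddCommGroup E] [InnerProductSpace ℝ E] [MeasurableSpace E]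
  [BorelSpace E] [FiniteDimensional ℝ E]
  {Ω β : Type*} [MeasurableSpace Ω] [MeasurableSpace β] {μ : Measure Ω} [IsProbabilityMeasure μ]
  {U G : Ω → E} {V : Ω → β} {κ : Kernel β E} [IsMarkovKernel κ]

lemma ofReal_smoothing {P : Measure E} [IsProbabilityMeasure P] {t : ℝ} (ht : 0 < t) (y : E) :
    ENNReal.ofReal (smoothing P (heatKernel t) y) =
      ∫⁻ u, ENNReal.ofReal (heatKernel t (y - u)) ∂P :=
  ofReal_integral_eq_lintegral_ofReal ((heatBounded_heatKernel ht).integrable_sub y)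
    (ae_of_all _ fun _ => (heatKernel_pos ht _).le)

lemma lintegral_comp_sqrt_smul_stdGaussian {t : ℝ} (ht : 0 < t) {f : E → ℝ≥0∞}
    (hf : Measurable f) (u : E) :
    ∫⁻ z, f (u + √(2 * t) • z) ∂stdGaussian E =
      ∫⁻ y, f y * ENNReal.ofReal (heatKernel t (y - u)) := by
  have hc := (continuous_heatKernel (E := E) t).measurable
  rw [← lintegral_map (f := fun z => f (u + z)) (g := fun z : E => √(2 * t) • z) (by fun_prop)
    (by fun_prop), map_smul_stdGaussian ht,
    lintegral_withDensity_eq_lintegral_mul _ (by fun_prop) (by fun_prop),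
    ← lintegral_add_left_eq_self (fun y => f y * ENNReal.ofReal (heatKernel t (y - u))) u]
  refine lintegral_congr fun y => ?_
  simp [mul_comm]

variable (hU : Measurable U) (hV : Measurable V) (hG : Measurable G)
  (hκ : μ.map (fun ω => (V ω, U ω)) = μ.map V ⊗ₘ κ)
  (hlaw : μ.map G = stdGaussian E) (hind : IndepFun (fun ω => (V ω, U ω)) G μ)
include hU hV hG hκ hlaw hind

lemma lintegral_noisy {t : ℝ} (ht : 0 < t) {f : β → E → E → ℝ≥0∞}
    (hf : Measurable fun w : β × E × E => f w.1 w.2.1 w.2.2) :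
    ∫⁻ ω, f (V ω) (U ω) (U ω + √(2 * t) • G ω) ∂μ =
      ∫⁻ v, ∫⁻ u, (∫⁻ y, f v u y * ENNReal.ofReal (heatKernel t (y - u))) ∂(κ v) ∂(μ.map V) := by
  have := Measure.isProbabilityMeasure_map (μ := μ) (hV.prodMk hU).aemeasurable
  have := Measure.isProbabilityMeasure_map (μ := μ) hV.aemeasurable
  have h1 : Measurable fun w : (β × E) × E => f w.1.1 w.1.2 (w.1.2 + √(2 * t) • w.2) :=
    hf.comp (g := fun w : β × E × E => f w.1 w.2.1 w.2.2)
      (f := fun w : (β × E) × E => (w.1.1, w.1.2, w.1.2 + √(2 * t) • w.2)) (by fun_prop)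
  have h2 : Measurable fun w : β × E => ∫⁻ z, f w.1 w.2 (w.2 + √(2 * t) • z) ∂stdGaussian E :=
    h1.lintegral_prod_right'
  have e := (indepFun_iff_map_prod_eq_prod_map_map (hV.prodMk hU).aemeasurable
    hG.aemeasurable).1 hind
  calc _ = ∫⁻ w, f w.1.1 w.1.2 (w.1.2 + √(2 * t) • w.2)
        ∂(μ.map fun ω => ((V ω, U ω), G ω)) := by
        rw [lintegral_map h1 ((hV.prodMk hU).prodMk hG)]
    _ = ∫⁻ v, ∫⁻ u, ∫⁻ z, f v u (u + √(2 * t) • z) ∂stdGaussian E ∂(κ v) ∂(μ.map V) := by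
        rw [e, lintegral_prod _ h1.aemeasurable, hκ, hlaw, Measure.lintegral_compProd h2]
    _ = _ := by
        refine lintegral_congr fun v => lintegral_congr fun u => ?_
        exact lintegral_comp_sqrt_smul_stdGaussian ht
          (hf.comp (g := fun w : β × E × E => f w.1 w.2.1 w.2.2)
            (f := fun y : E => (v, u, y)) (by fun_prop)) u

lemma lintegral_noisy_fst {t : ℝ} (ht : 0 < t) {f : β → E → ℝ≥0∞}
    (hf : Measurable fun w : β × E => f w.1 w.2) :
    ∫⁻ ω, f (V ω) (U ω + √(2 * t) • G ω) ∂μ =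
      ∫⁻ v, (∫⁻ y, f v y * ENNReal.ofReal (smoothing (κ v) (heatKernel t) y)) ∂(μ.map V) := by
  have hc := (continuous_heatKernel (E := E) t).measurable
  rw [lintegral_noisy hU hV hG hκ hlaw hind ht (f := fun v _ y => f v y)
    (hf.comp (f := fun w : β × E × E => (w.1, w.2.2)) (by fun_prop))]
  refine lintegral_congr fun v => ?_
  have hfv : Measurable (f v) := hf.comp (f := fun y : E => (v, y)) (by fun_prop)
  rw [lintegral_lintegral_swap (Measurable.aemeasurable (by unfold Function.uncurry; fun_prop))]
  refine lintegral_congr fun y => ?_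
  rw [ofReal_smoothing ht, lintegral_const_mul _ (by fun_prop)]

omit hU hV hG hκ hlaw hind in
/-- The posterior law of the signal given the noisy observation and the side information. -/
noncomputable def posteriorKernel (κ : Kernel β E) [IsMarkovKernel κ] (t : ℝ) :
    Kernel (E × β) E :=
  (κ.comap Prod.snd measurable_snd).withDensity fun w u =>
    ENNReal.ofReal (heatKernel t (w.1 - u) / smoothing (κ w.2) (heatKernel t) w.1)

omit hU hV hG hκ hlaw hind in
lemma measurable_posteriorDensity (t : ℝ) : Measurable (Function.uncurry fun (w : E × β) (u : E) =>
    ENNReal.ofReal (heatKernel t (w.1 - u) / smoothing (κ w.2) (heatKernel t) w.1)) := by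
  have hc := (continuous_heatKernel (E := E) t).measurable
  have hs : Measurable fun w : (E × β) × E => smoothing (κ w.1.2) (heatKernel t) w.1.1 :=
    (measurable_smoothing_heatKernel_kernel κ).comp
      (f := fun w : (E × β) × E => (w.1.2, t, w.1.1)) (by fun_prop)
  unfold Function.uncurry
  exact (Measurable.div (by fun_prop) hs).ennreal_ofReal

omit hU hV hG hκ hlaw hind in
lemma posteriorKernel_apply (t : ℝ) (y : E) (v : β) :
    posteriorKernel κ t (y, v) = (κ v).withDensity fun u =>
      ENNReal.ofReal (heatKernel t (y - u) / smoothing (κ v) (heatKernel t) y) := by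
  rw [posteriorKernel, Kernel.withDensity_apply _ (measurable_posteriorDensity t)]
  rfl

omit hU hV hG hκ hlaw hind in
lemma isMarkovKernel_posteriorKernel {t : ℝ} (ht : 0 < t) :
    IsMarkovKernel (posteriorKernel κ t) := by
  refine ⟨fun ⟨y, v⟩ => ⟨?_⟩⟩
  have hp := smoothing_heatKernel_pos (κ v) ht y
  have hc := (continuous_heatKernel (E := E) t).measurable
  rw [posteriorKernel_apply, withDensity_apply _ MeasurableSet.univ, Measure.restrict_univ]
  simp_rw [div_eq_mul_inv, ENNReal.ofReal_mul (heatKernel_pos ht _).le]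
  rw [lintegral_mul_const _ (by fun_prop), ← ofReal_smoothing ht, ← ENNReal.ofReal_mul hp.le,
    mul_inv_cancel₀ hp.ne', ENNReal.ofReal_one]

omit hU hV hG hκ hlaw hind in
lemma integral_posteriorKernel {t : ℝ} (ht : 0 < t) (y : E) (v : β) :
    ∫ u, u ∂(posteriorKernel κ t (y, v)) = postMean (κ v) t y := by
  have hp := smoothing_heatKernel_pos (κ v) ht y
  have hc := (continuous_heatKernel (E := E) t).measurable
  rw [posteriorKernel_apply, integral_withDensity_eq_integral_toReal_smul (by fun_prop) (by simp),
    postMean, ← integral_smul]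
  refine integral_congr_ae (ae_of_all _ fun u => ?_)
  simp only
  rw [ENNReal.toReal_ofReal (div_nonneg (heatKernel_pos ht _).le hp.le), smul_smul, div_eq_inv_mul]

/-- Bayes' rule: given `V = v`, the pair of signal and observation has density `heatKernel t (y -
u)` with respect to `κ v × volume`, and dividing by the observation density `smoothing (κ v)
(heatKernel t) y` gives the posterior. -/
lemma map_noisy_eq_compProd {t : ℝ} (ht : 0 < t) :
    μ.map (fun ω => ((U ω + √(2 * t) • G ω, V ω), U ω)) =
      μ.map (fun ω => (U ω + √(2 * t) • G ω, V ω)) ⊗ₘ posteriorKernel κ t := by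
  have := isMarkovKernel_posteriorKernel (κ := κ) ht
  have hc := (continuous_heatKernel (E := E) t).measurable
  have hY : Measurable fun ω => (U ω + √(2 * t) • G ω, V ω) := by fun_prop
  have := Measure.isProbabilityMeasure_map (μ := μ) hY.aemeasurable
  refine Measure.ext_of_lintegral _ fun f hf => ?_
  have hg : Measurable fun w : E × β => ∫⁻ u, f (w, u) ∂(posteriorKernel κ t w) :=
    hf.lintegral_kernel_prod_right'
  rw [lintegral_map hf (hY.prodMk hU), Measure.lintegral_compProd hf, lintegral_map hg hY,
    lintegral_noisy hU hV hG hκ hlaw hind ht (f := fun v u y => f ((y, v), u))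
      (hf.comp (f := fun w : β × E × E => ((w.2.2, w.1), w.2.1)) (by fun_prop)),
    lintegral_noisy_fst hU hV hG hκ hlaw hind ht
      (f := fun v y => ∫⁻ u, f ((y, v), u) ∂(posteriorKernel κ t (y, v)))
      (hg.comp (f := fun w : β × E => (w.2, w.1)) (by fun_prop))]
  refine lintegral_congr fun v => ?_
  rw [lintegral_lintegral_swap (Measurable.aemeasurable (by unfold Function.uncurry; fun_prop))]
  refine lintegral_congr fun y => ?_
  have hp := smoothing_heatKernel_pos (κ v) ht y
  rw [posteriorKernel_apply, lintegral_withDensity_eq_lintegral_mul _ (by fun_prop) (by fun_prop),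
    ← lintegral_mul_const _ (by fun_prop)]
  refine lintegral_congr fun u => ?_
  rw [Pi.mul_apply, mul_right_comm, ← ENNReal.ofReal_mul
    (div_nonneg (heatKernel_pos ht _).le hp.le), div_mul_cancel₀ _ hp.ne', mul_comm]

/-- The conditional expectation of the signal is the posterior mean. -/
theorem condExp_ae_eq_postMean [StandardBorelSpace E] (hint : Integrable U μ) {t : ℝ}
    (ht : 0 < t) :
    μ[U | MeasurableSpace.comap (fun ω => (U ω + √(2 * t) • G ω, V ω)) inferInstance] =ᵐ[μ]
      fun ω => postMean (κ (V ω)) t (U ω + √(2 * t) • G ω) := by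
  have := isMarkovKernel_posteriorKernel (κ := κ) ht
  have hY : Measurable fun ω => (U ω + √(2 * t) • G ω, V ω) := by fun_prop
  have h1 := condDistrib_ae_eq_of_measure_eq_compProd_of_measurable hY hU
    (map_noisy_eq_compProd hU hV hG hκ hlaw hind ht)
  have h2 := condExp_prod_ae_eq_integral_condDistrib' hY hU.aemeasurable
    (f := fun w : (E × β) × E => w.2) ((integrable_map_measure (by fun_prop)
      (hY.prodMk hU).aemeasurable).2 hint)
  refine h2.trans ?_
  filter_upwards [ae_of_ae_map hY.aemeasurable h1] with ω hω
  rw [hω, integral_posteriorKernel ht]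

end Posterior

/-! ### The identity for the mutual information of one component. -/

section Component

open Real Filter Topology

variable {E : Type*} [NormedAddCommGroup E] [InnerProductSpace ℝ E] [MeasurableSpace E]
  [BorelSpace E] [FiniteDimensional ℝ E] [StandardBorelSpace E]
  {Ω β : Type*} [MeasurableSpace Ω] [MeasurableSpace β] {μ : Measure Ω} [IsProbabilityMeasure μ]
  {U G : Ω → E} {V : Ω → β} {κ : Kernel β E} [IsMarkovKernel κ]

/-- The mean squared distance at noise level `t` between the posterior means with and without side
information, where `κ` is the conditional law of the signal, `ν` the law of the side information
and `P` the law of the signal. -/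
noncomputable def meanDenoisingGap (ν : Measure β) (κ : Kernel β E) (P : Measure E) (t : ℝ) :
    ℝ≥0∞ :=
  ∫⁻ v, (∫⁻ y, ENNReal.ofReal (denoisingGapDensity (κ v) P t y)) ∂ν

lemma measurable_meanDenoisingGap_uncurry (P : Measure E) [IsProbabilityMeasure P] :
    Measurable fun w : β × ℝ => ∫⁻ y, ENNReal.ofReal (denoisingGapDensity (κ w.1) P w.2 y) := by
  simpa using measurable_lintegral_denoisingGapDensity_kernel κ (Kernel.const β P)

lemma measurable_meanDenoisingGap (ν : Measure β) [SFinite ν] (P : Measure E)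
    [IsProbabilityMeasure P] : Measurable (meanDenoisingGap ν κ P) :=
  (measurable_meanDenoisingGap_uncurry P).lintegral_prod_left'

/-- The two-measure identity is applied to `κ v` and the marginal law for each `v`; Tonelli's
theorem exchanges the average over `v` with the integral over `t`. -/
theorem mutualInformation_eq_lintegral_meanDenoisingGap (hU : Measurable U) (hV : Measurable V)
    (hκ : μ.map (fun ω => (V ω, U ω)) = μ.map V ⊗ₘ κ) :
    mutualInformation μ U V = ∫⁻ t in Set.Ioi (0 : ℝ), ENNReal.ofReal (1 / (4 * t ^ 2)) *
      meanDenoisingGap (μ.map V) κ (μ.map U) t := by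
  have := Measure.isProbabilityMeasure_map (μ := μ) hU.aemeasurable
  have := Measure.isProbabilityMeasure_map (μ := μ) hV.aemeasurable
  rw [mutualInformation_eq_lintegral_klDiv hU hV hκ]
  simp_rw [klDiv_eq_denoisingDiv, denoisingDiv, meanDenoisingGap]
  have hm := measurable_meanDenoisingGap_uncurry (κ := κ) (μ.map U)
  rw [lintegral_lintegral_swap (Measurable.aemeasurable (by
    unfold Function.uncurry
    exact Measurable.mul (by fun_prop) hm))]
  refine lintegral_congr fun t => ?_
  have hmt : Measurable fun v : β =>
      ∫⁻ y, ENNReal.ofReal (denoisingGapDensity (κ v) (μ.map U) t y) :=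
    hm.comp (f := fun v : β => (v, t)) (by fun_prop)
  exact lintegral_const_mul _ hmt

lemma comap_prodMk_const {α : Type*} [MeasurableSpace α] (f : Ω → α) :
    MeasurableSpace.comap (fun ω => (f ω, ())) inferInstance =
      MeasurableSpace.comap f inferInstance := by
  apply le_antisymm
  · rintro _ ⟨s, hs, rfl⟩
    exact ⟨(fun a => (a, ())) ⁻¹' s, measurable_prodMk_right hs, rfl⟩
  · rintro _ ⟨s, hs, rfl⟩
    exact ⟨Prod.fst ⁻¹' s, measurable_fst hs, rfl⟩

variable (hU : Measurable U) (hG : Measurable G) (hlaw : μ.map G = stdGaussian E)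
  (hint : Integrable U μ)
include hU hG hlaw hint

lemma condExp_ae_eq_postMean_marginal (hind : IndepFun U G μ) {t : ℝ} (ht : 0 < t) :
    μ[U | MeasurableSpace.comap (fun ω => U ω + √(2 * t) • G ω) inferInstance] =ᵐ[μ]
      fun ω => postMean (μ.map U) t (U ω + √(2 * t) • G ω) := by
  have := Measure.isProbabilityMeasure_map (μ := μ) hU.aemeasurable
  -- No side information is modelled by side information in `Unit`, for which the conditional law of
  -- the signal is its marginal.
  have hκ : μ.map (fun ω => ((), U ω)) = μ.map (fun _ => ()) ⊗ₘ Kernel.const Unit (μ.map U) := by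
    rw [Measure.compProd_const, Measure.map_const, measure_univ, one_smul, Measure.dirac_prod,
      Measure.map_map (by fun_prop) hU]
    rfl
  have h := condExp_ae_eq_postMean hU measurable_const hG hκ hlaw
    (hind.comp (φ := fun u => ((), u)) (by fun_prop) measurable_id) hint ht
  rw [comap_prodMk_const] at h
  simpa using h

variable (hV : Measurable V) (hκ : μ.map (fun ω => (V ω, U ω)) = μ.map V ⊗ₘ κ)
  (hind : IndepFun (fun ω => (V ω, U ω)) G μ)
include hV hκ hind

theorem ae_enorm_condExp_sub_eq {t : ℝ} (ht : 0 < t) :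
    ∀ᵐ ω ∂μ, ‖(μ[U | MeasurableSpace.comap (fun ω => U ω + √(2 * t) • G ω) inferInstance]) ω -
        (μ[U | MeasurableSpace.comap (fun ω => (U ω + √(2 * t) • G ω, V ω)) inferInstance]) ω‖ₑ ^ 2
      = ‖postMean (κ (V ω)) t (U ω + √(2 * t) • G ω) -
          postMean (μ.map U) t (U ω + √(2 * t) • G ω)‖ₑ ^ 2 := by
  filter_upwards [condExp_ae_eq_postMean_marginal hU hG hlaw hint
      (hind.comp measurable_snd measurable_id) ht,
    condExp_ae_eq_postMean hU hV hG hκ hlaw hind hint ht] with ω h1 h2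
  rw [h1, h2, ← enorm_neg, neg_sub]

omit hint in
theorem lintegral_enorm_postMean_sub_eq {t : ℝ} (ht : 0 < t) :
    ∫⁻ ω, ‖postMean (κ (V ω)) t (U ω + √(2 * t) • G ω) -
          postMean (μ.map U) t (U ω + √(2 * t) • G ω)‖ₑ ^ 2 ∂μ =
      meanDenoisingGap (μ.map V) κ (μ.map U) t := by
  have := Measure.isProbabilityMeasure_map (μ := μ) hU.aemeasurable
  have hm : Measurable fun w : β × E =>
      ‖postMean (κ w.1) t w.2 - postMean (μ.map U) t w.2‖ₑ ^ 2 :=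
    (((measurable_postMean_kernel κ).sub
      (measurable_postMean_kernel (Kernel.const β (μ.map U)))).comp
      (f := fun w : β × E => (w.1, t, w.2)) (by fun_prop)).enorm.pow_const 2
  rw [lintegral_noisy_fst hU hV hG hκ hlaw hind ht
    (f := fun v y => ‖postMean (κ v) t y - postMean (μ.map U) t y‖ₑ ^ 2) hm]
  refine lintegral_congr fun v => lintegral_congr fun y => ?_
  rw [denoisingGapDensity, mul_comm, ENNReal.ofReal_mul (smoothing_heatKernel_pos _ ht y).le,
    ENNReal.ofReal_pow (norm_nonneg _), ofReal_norm]

end Component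

/-! ### Assembling the components of the system. -/

section System

open Filter

variable {N : ℕ} {d : Fin N → ℕ}

lemma measurable_sysVec_apply (i : Fin N) : Measurable fun x : SysVec d => x i :=
  (PiLp.continuous_apply 2 _ i).measurable

lemma measurable_allBut (i : Fin N) : Measurable (allBut (d := d) i) :=
  measurable_pi_lambda _ fun j => measurable_sysVec_apply j.1

lemma map_sysVec_apply_stdGaussian (i : Fin N) :
    (stdGaussian (SysVec d)).map (fun x => x i) = stdGaussian (EuclideanSpace ℝ (Fin (d i))) := by
  have := Measure.isProbabilityMeasure_map (μ := stdGaussian (SysVec d))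
    (measurable_sysVec_apply i).aemeasurable
  apply Measure.ext_of_charFunDual
  ext L
  have e : (fun x : SysVec d => x i) =
      PiLp.proj (𝕜 := ℝ) 2 (fun i : Fin N => EuclideanSpace ℝ (Fin (d i))) i := rfl
  rw [e, charFunDual_map, charFunDual_stdGaussian, charFunDual_stdGaussian]
  -- The characteristic function of a standard Gaussian at `L` depends only on `‖L‖`, so it remains
  -- to see that composing with a coordinate projection preserves the dual norm; the
  -- single-coordinate embedding gives the reverse inequality.
  congr 5
  refine le_antisymm ?_ ?_
  · refine ContinuousLinearMap.opNorm_le_bound _ (norm_nonneg _) fun x => ?_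
    refine (L.le_opNorm _).trans ?_
    gcongr
    exact PiLp.norm_apply_le x i
  · refine ContinuousLinearMap.opNorm_le_bound _ (norm_nonneg _) fun y => ?_
    have h := (L.comp (PiLp.proj (𝕜 := ℝ) 2
      (fun i : Fin N => EuclideanSpace ℝ (Fin (d i))) i)).le_opNorm (PiLp.single 2 i y)
    simpa [PiLp.norm_single] using h

lemma enorm_sq_sysVec (x : SysVec d) : ‖x‖ₑ ^ 2 = ∑ i, ‖x i‖ₑ ^ 2 := by
  simp_rw [← ofReal_norm, ← ENNReal.ofReal_pow (norm_nonneg _)]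
  rw [PiLp.norm_sq_eq_of_L2, ENNReal.ofReal_sum_of_nonneg fun i _ => sq_nonneg _]

end System

theorem proposition3 {Ω : Type*} [MeasurableSpace Ω] (μ : Measure Ω) [IsProbabilityMeasure μ]
    (N : ℕ) (d : Fin N → ℕ) (X W : Ω → SysVec d)
    (hX : Measurable X) (hXint : Integrable X μ)
    (hW : Measurable W) (hWlaw : μ.map W = stdGaussian (SysVec d))
    (hXW : IndepFun X W μ) :
    sInformation μ X =
      ∫⁻ t in Set.Ioi (0 : ℝ), ENNReal.ofReal (1 / (4 * t ^ 2)) *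
        ∫⁻ ω, ‖marginalDenoiser μ X W t ω - conditionalDenoiser μ X W t ω‖ₑ ^ 2 ∂μ := by
  have hU : ∀ i, Measurable fun ω => X ω i := fun i => (measurable_sysVec_apply i).comp hX
  have hG : ∀ i, Measurable fun ω => W ω i := fun i => (measurable_sysVec_apply i).comp hW
  have hV : ∀ i, Measurable fun ω => allBut i (X ω) := fun i => (measurable_allBut i).comp hX
  have hint : ∀ i, Integrable (fun ω => X ω i) μ := fun i =>
    (PiLp.proj (𝕜 := ℝ) 2 (fun i : Fin N => EuclideanSpace ℝ (Fin (d i))) i).integrable_comp hXint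
  have hlaw : ∀ i, μ.map (fun ω => W ω i) = stdGaussian (EuclideanSpace ℝ (Fin (d i))) := fun i =>
    by rw [← map_sysVec_apply_stdGaussian, ← hWlaw, Measure.map_map (measurable_sysVec_apply i) hW]
       rfl
  have hind : ∀ i, IndepFun (fun ω => (allBut i (X ω), X ω i)) (fun ω => W ω i) μ := fun i =>
    hXW.comp ((measurable_allBut i).prodMk (measurable_sysVec_apply i)) (measurable_sysVec_apply i)
  set κ := fun i => condDistrib (fun ω => X ω i) (fun ω => allBut i (X ω)) μ with hκdef
  have hκ : ∀ i, μ.map (fun ω => (allBut i (X ω), X ω i)) =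
      μ.map (fun ω => allBut i (X ω)) ⊗ₘ κ i := fun i =>
    (compProd_map_condDistrib (hU i).aemeasurable).symm
  have hprob := fun i => Measure.isProbabilityMeasure_map (μ := μ) (hU i).aemeasurable
  -- The squared norm of the concatenated vector splits into a sum over components, each of which is
  -- a mean denoising gap.
  have key : ∀ t ∈ Set.Ioi (0 : ℝ),
      ∫⁻ ω, ‖marginalDenoiser μ X W t ω - conditionalDenoiser μ X W t ω‖ₑ ^ 2 ∂μ =
      ∑ i, meanDenoisingGap (μ.map fun ω => allBut i (X ω)) (κ i) (μ.map fun ω => X ω i) t := by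
    intro t ht
    have hae : ∀ᵐ ω ∂μ, ∀ i, ‖(marginalDenoiser μ X W t ω - conditionalDenoiser μ X W t ω) i‖ₑ ^ 2 =
        ‖postMean (κ i (allBut i (X ω))) t (X ω i + √(2 * t) • W ω i) -
          postMean (μ.map fun ω => X ω i) t (X ω i + √(2 * t) • W ω i)‖ₑ ^ 2 :=
      ae_all_iff.2 fun i =>
        ae_enorm_condExp_sub_eq (hU i) (hG i) (hlaw i) (hint i) (hV i) (hκ i) (hind i) ht
    simp_rw [enorm_sq_sysVec]
    rw [lintegral_congr_ae (hae.mono fun ω h => Finset.sum_congr rfl fun i _ => h i),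
      lintegral_finsetSum]
    · exact Finset.sum_congr rfl fun i _ =>
        lintegral_enorm_postMean_sub_eq (hU i) (hG i) (hlaw i) (hV i) (hκ i) (hind i) ht
    · intro i _
      have hm := (measurable_postMean_kernel (κ i)).sub
        (measurable_postMean_kernel (Kernel.const _ (μ.map fun ω => X ω i)))
      have hnoisy : Measurable fun ω => X ω i + √(2 * t) • W ω i :=
        (hU i).add ((hG i).const_smul (√(2 * t)))
      exact (hm.comp (f := fun ω => (allBut i (X ω), t, X ω i + √(2 * t) • W ω i))
        ((hV i).prodMk (measurable_const.prodMk hnoisy))).enorm.pow_const 2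
  have hm : ∀ i ∈ Finset.univ, Measurable fun t : ℝ => ENNReal.ofReal (1 / (4 * t ^ 2)) *
      meanDenoisingGap (μ.map fun ω => allBut i (X ω)) (κ i) (μ.map fun ω => X ω i) t :=
    fun i _ => Measurable.mul (by fun_prop) (measurable_meanDenoisingGap _ _)
  rw [setLIntegral_congr_fun measurableSet_Ioi fun t ht => by rw [key t ht, Finset.mul_sum],
    lintegral_finsetSum _ hm, sInformation]
  exact Finset.sum_congr rfl fun i _ =>
    mutualInformation_eq_lintegral_meanDenoisingGap (hU i) (hV i) (hκ i)
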